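/- Let $y$ and $(x_n)_{n\ge 1}$ be indeterminates over $\mathbb{Q}$. For prime ideals $P_1,\dots,P_m$ of a domain $A$, write $A_{P_1\cup\cdots\cup P_m}$ for the ring of fractions of $A$ with denominators in $A\setminus(P_1\cup\cdots\cup P_m)$. Inside $\mathbb{Q}(y,x_1,x_2,\dots)$ consider the domain $$C=\bigcup_{n\ge 1}\mathbb{Q}\Big[x_1,\dots,x_n,\tfrac{y}{x_1\cdots x_n}\Big]_{(x_1)\cup\cdots\cup(x_n)\cup\left(\frac{y}{x_1\cdots x_n}\right)} .$$ An SP-domain is a domain in which every ideal is a product of radical ideals. An ISP-domain is a domain in which every proper nonzero ideal has the form $JQ_1\cdots Q_r$ with $r\ge 1$, $J$ an invertible ideal and each $Q_i$ a proper radical ideal. A domain $A$ is h-local if $A/P$ is local for every nonzero prime ideal $P$ and $A/I$ has only finitely many maximal ideals for every nonzero ideal $I$. Then: 1. $C$ is a one-dimensional Bezout SP-domain that is not a Dedekind domain. 2. The maximal ideals of $C$ are exactly $N=\sum_{n\ge 1}\frac{y}{x_1\cdots x_n}C$ and the principal ideals $x_nC$, $n\ge 1$. 3. Let $K=\mathbb{Q}(x_n;\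 n\ge 2)$ and let $t$ be an indeterminate over $K$. There is a ring isomorphism $C/x_1C\cong K(t)$ sending the class of $x_n$ to $x_n$ for every $n\ge 2$ and the class of $y/x_1$ to $t$. Let $D\subseteq C/x_1C$ be the subring corresponding to $K[t]_{(t)}$, let $\pi:C\to C/x_1C$ be the canonical map and put $p=x_1+y/x_1$. Then $x_1C$ is a maximal ideal of $C$, $D$ is a discrete valuation ring with quotient field $C/x_1C$, $p$ is a unit of $C$, and $\pi(p)$ generates the maximal ideal of $D$. 4. The pullback domain $A=\pi^{-1}(D)$ is a two-dimensional ISP-domain which is not h-local. In particular, two-dimensional ISP-domains which are not h-local exist. -/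

import Mathlib

noncomputable section

/-! ## Classes of domains -/

/-- An SP-domain: every ideal is a product of radical ideals. -/
def IsSPDomain (A : Type*) [CommRing A] [IsDomain A] : Prop :=
  ∀ I : Ideal A, ∃ Q : Multiset (Ideal A), (∀ J ∈ Q, J.IsRadical) ∧ Q.prod = I

/-- An ideal of a domain is invertible if it is invertible as a fractional ideal. -/
def IsInvertibleIdeal {A : Type*} [CommRing A] [IsDomain A] (J : Ideal A) : Prop :=
  IsUnit (J : FractionalIdeal (nonZeroDivisors A) (FractionRing A))

/-- An ISP-domain: every proper nonzero ideal is an invertible ideal times a nonempty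
finite product of proper radical ideals. -/
def IsISPDomain (A : Type*) [CommRing A] [IsDomain A] : Prop :=
  ∀ I : Ideal A, I ≠ ⊤ → I ≠ ⊥ →
    ∃ (J : Ideal A) (Q : Multiset (Ideal A)), IsInvertibleIdeal J ∧ Q ≠ 0 ∧
      (∀ H ∈ Q, H ≠ ⊤ ∧ H.IsRadical) ∧ I = J * Q.prod

/-- An h-local domain: `A ⧸ P` is local for every nonzero prime ideal `P`, and `A ⧸ I` has only
finitely many maximal ideals for every nonzero ideal `I`. -/
def IsHLocal (A : Type*) [CommRing A] [IsDomain A] : Prop :=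
  (∀ P : Ideal A, P.IsPrime → P ≠ ⊥ → IsLocalRing (A ⧸ P)) ∧
    ∀ I : Ideal A, I ≠ ⊥ → Finite (MaximalSpectrum (A ⧸ I))

/-- The data needed for the pullback construction: an SP-domain `C` which is not Dedekind, a
principal maximal ideal `qC`, a DVR `D` with quotient field `C ⧸ qC`, and a unit `p` of `C`
whose residue class generates the maximal ideal of `D`. -/
structure IsPullbackData (C : Type*) [CommRing C] [IsDomain C] (q p : C)
    (D : Subring (C ⧸ Ideal.span {q})) : Prop where
  isSPDomain : IsSPDomain C
  not_isDedekindDomain : ¬ IsDedekindDomain C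
  isMaximal : (Ideal.span {q}).IsMaximal
  isFractionRing : IsFractionRing D (C ⧸ Ideal.span {q})
  isUnit : IsUnit p
  dvr_and_generator : ∃ (_ : IsDomain D) (_ : IsDiscreteValuationRing D)
    (hp : Ideal.Quotient.mk (Ideal.span {q}) p ∈ D),
    IsLocalRing.maximalIdeal D = Ideal.span {⟨Ideal.Quotient.mk (Ideal.span {q}) p, hp⟩}

/-- The pullback `π⁻¹(D)` of a subring `D` of `C ⧸ qC` along `π : C → C ⧸ qC`. -/
def pullbackRing {C : Type*} [CommRing C] (q : C) (D : Subring (C ⧸ Ideal.span {q})) : Subring C :=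
  D.comap (Ideal.Quotient.mk (Ideal.span {q}))

/-! ## The domain `C` -/

namespace ExampleC

open MvPolynomial

/-- `ℚ[y, x₁, x₂, …]`; the variable `none` is `y` and the variable `some n` is `xₙ`. -/
abbrev Poly : Type := MvPolynomial (Option ℕ+) ℚ

/-- `ℚ(y, x₁, x₂, …)`. -/
abbrev RatField : Type := FractionRing Poly

def y : RatField := algebraMap Poly RatField (X none)

def x (n : ℕ+) : RatField := algebraMap Poly RatField (X (some n))

/-- `z n = y / (x₁ ⋯ xₙ)`. -/
def z (n : ℕ+) : RatField := y / ∏ i ∈ Finset.Icc 1 n, x i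

/-- `ℚ[x₁, …, xₙ, y / (x₁ ⋯ xₙ)]`. -/
def polySub (n : ℕ+) : Subalgebra ℚ RatField :=
  Algebra.adjoin ℚ (x '' Set.Icc 1 n ∪ {z n})

theorem x_mem {n i : ℕ+} (hi : i ≤ n) : x i ∈ polySub n :=
  Algebra.subset_adjoin (Or.inl ⟨i, ⟨one_le, hi⟩, rfl⟩)

theorem z_mem (n : ℕ+) : z n ∈ polySub n :=
  Algebra.subset_adjoin (Or.inr rfl)

/-- The ideal `(xᵢ)` of `ℚ[x₁, …, xₙ, y / (x₁ ⋯ xₙ)]`, for `i ≤ n`. -/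
def idealX {n i : ℕ+} (hi : i ≤ n) : Ideal (polySub n) := Ideal.span {⟨x i, x_mem hi⟩}

/-- The ideal `(y / (x₁ ⋯ xₙ))` of `ℚ[x₁, …, xₙ, y / (x₁ ⋯ xₙ)]`. -/
def idealZ (n : ℕ+) : Ideal (polySub n) := Ideal.span {⟨z n, z_mem n⟩}

section Auxiliary

theorem x_ne_zero (n : ℕ+) : x n ≠ 0 := by
  unfold x
  rw [Ne, FaithfulSMul.algebraMap_eq_zero_iff]
  exact X_ne_zero _

theorem z_eq (n : ℕ+) : z n = x (n + 1) * z (n + 1) := by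
  have h : Finset.Icc 1 (n + 1) = insert (n + 1) (Finset.Icc 1 n) := by
    ext i
    simp only [Finset.mem_Icc, Finset.mem_insert, ← PNat.coe_le_coe, ← PNat.coe_inj, PNat.add_coe,
      PNat.one_coe]
    have := i.pos
    omega
  have hn : n + 1 ∉ Finset.Icc 1 n := by
    simp only [Finset.mem_Icc, ← PNat.coe_le_coe, PNat.add_coe, PNat.one_coe]
    omega
  have h1 := x_ne_zero (n + 1)
  have h2 : ∏ i ∈ Finset.Icc 1 n, x i ≠ 0 := Finset.prod_ne_zero_iff.2 fun i _ => x_ne_zero i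
  unfold z
  rw [h, Finset.prod_insert hn]
  field_simp

/-- The generators: `none ↦ y / (x₁ ⋯ xₙ)`, `some i ↦ xᵢ`. -/
def gen (n : ℕ+) (o : Option ℕ+) : RatField := o.elim (z n) x

theorem gen_algebraicIndependent (n : ℕ+) : AlgebraicIndependent ℚ (gen n) := by
  have h0 : AlgebraicIndependent ℚ (fun o : Option ℕ+ => o.elim y x) := by
    have h1 : (aeval (fun o : Option ℕ+ => o.elim y x) : Poly →ₐ[ℚ] RatField).toRingHom
        = algebraMap Poly RatField := by
      apply MvPolynomial.ringHom_ext
      · intro r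
        exact RingHom.congr_fun (Subsingleton.elim
          ((aeval (fun o : Option ℕ+ => o.elim y x) : Poly →ₐ[ℚ] RatField).toRingHom.comp C)
          ((algebraMap Poly RatField).comp C)) r
      · rintro (_ | i) <;> simp [x, y]
    intro p q hpq
    have h2 : algebraMap Poly RatField p = algebraMap Poly RatField q := by
      rw [← h1]
      exact hpq
    exact FaithfulSMul.algebraMap_injective Poly RatField h2
  obtain ⟨hx, hy⟩ := AlgebraicIndependent.option_iff.1 h0
  refine AlgebraicIndependent.option_iff.2 ⟨hx, fun hz => hy ?_⟩
  have hm : ∏ i ∈ Finset.Icc 1 n, x i ∈ Algebra.adjoin ℚ (Set.range x) :=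
    Subalgebra.prod_mem _ fun i _ => Algebra.subset_adjoin ⟨i, rfl⟩
  have h2 : ∏ i ∈ Finset.Icc 1 n, x i ≠ 0 := Finset.prod_ne_zero_iff.2 fun i _ => x_ne_zero i
  have h3 := hz.mul (isAlgebraic_algebraMap (A := RatField)
    (⟨_, hm⟩ : Algebra.adjoin ℚ (Set.range x)))
  have h4 : z n * algebraMap (Algebra.adjoin ℚ (Set.range x)) RatField ⟨_, hm⟩ = y :=
    div_mul_cancel₀ _ h2
  rwa [h4] at h3

theorem aeval_mem {n : ℕ+} {r : Option ℕ+ → RatField} (hr : ∀ j, r j ∈ polySub n) (P : Poly) :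
    aeval r P ∈ polySub n := by
  induction P using MvPolynomial.induction_on with
  | C a => simpa using (polySub n).algebraMap_mem a
  | add p q hp hq => simpa using (polySub n).add_mem hp hq
  | mul_X p i hp => simpa using (polySub n).mul_mem hp (hr i)

theorem lift_fixed {n m : ℕ+} {r : Option ℕ+ → RatField}
    (hx : ∀ i ≤ n, r (some i) = x i)
    (hz : ∃ P : Poly, aeval (gen m) P = z n ∧ aeval r P = z n) {a : RatField}
    (ha : a ∈ polySub n) : ∃ P : Poly, aeval (gen m) P = a ∧ aeval r P = a := by
  induction ha using Algebra.adjoin_induction with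
  | mem a h =>
    rcases h with ⟨i, hi, rfl⟩ | rfl
    · exact ⟨X (some i), by simp [gen], by simp [hx i hi.2]⟩
    · exact hz
  | algebraMap c => exact ⟨C c, by simp, by simp⟩
  | add a b _ _ ha hb =>
    obtain ⟨P, h1, h2⟩ := ha
    obtain ⟨Q, h3, h4⟩ := hb
    exact ⟨P + Q, by simp [h1, h3], by simp [h2, h4]⟩
  | mul a b _ _ ha hb =>
    obtain ⟨P, h1, h2⟩ := ha
    obtain ⟨Q, h3, h4⟩ := hb
    exact ⟨P * Q, by simp [h1, h3], by simp [h2, h4]⟩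

theorem div_descend {n m : ℕ+} {r : Option ℕ+ → RatField} (hr : ∀ j, r j ∈ polySub n)
    (hx : ∀ i ≤ n, r (some i) = x i)
    (hz : ∃ P : Poly, aeval (gen m) P = z n ∧ aeval r P = z n) {a b : RatField}
    (ha : a ∈ polySub n) (hb : b ∈ polySub m) (j : Option ℕ+) (hab : gen m j * b = a) :
    ∃ c ∈ polySub n, r j * c = a := by
  obtain ⟨P, hP, hP'⟩ := lift_fixed hx hz ha
  obtain ⟨Q, hQ, -⟩ := lift_fixed (n := m) (m := m) (r := gen m) (fun _ _ => rfl)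
    ⟨X none, by simp [gen], by simp [gen]⟩ hb
  have h : P = X j * Q := gen_algebraicIndependent m (by simp [hP, hQ, hab])
  exact ⟨aeval r Q, aeval_mem hr Q, by rw [← hP', h]; simp⟩

/-- Substitution killing the variables that do not occur in `polySub n`. -/
def trunc (n : ℕ+) (o : Option ℕ+) : RatField := o.elim (z n) fun i => if i ≤ n then x i else 1

theorem gen_prime {n : ℕ+} {j : Option ℕ+} (hj : trunc n j = gen n j) {a b c : RatField}
    (ha : a ∈ polySub n) (hb : b ∈ polySub n) (hc : c ∈ polySub n) (h : gen n j * c = a * b) :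
    (∃ d ∈ polySub n, gen n j * d = a) ∨ ∃ d ∈ polySub n, gen n j * d = b := by
  have hr : ∀ j, trunc n j ∈ polySub n := by
    rintro (_ | i)
    · exact z_mem n
    · by_cases hi : i ≤ n
      · simpa [trunc, hi] using x_mem hi
      · simp [trunc, hi]
  have hx : ∀ i ≤ n, trunc n (some i) = x i := fun i hi => by simp [trunc, hi]
  have hz : ∃ P : Poly, aeval (gen n) P = z n ∧ aeval (trunc n) P = z n :=
    ⟨X none, by simp [gen], by simp [trunc]⟩
  obtain ⟨P, hP, hP'⟩ := lift_fixed hx hz ha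
  obtain ⟨Q, hQ, hQ'⟩ := lift_fixed hx hz hb
  obtain ⟨R, hR, -⟩ := lift_fixed hx hz hc
  have hPQ : X j * R = P * Q := gen_algebraicIndependent n (by simp [hP, hQ, hR, h])
  rcases (X_prime (R := ℚ) (i := j)).dvd_or_dvd ⟨R, hPQ.symm⟩ with ⟨S, hS⟩ | ⟨S, hS⟩
  · exact Or.inl ⟨aeval (trunc n) S, aeval_mem hr S, by rw [← hP', hS, ← hj]; simp⟩
  · exact Or.inr ⟨aeval (trunc n) S, aeval_mem hr S, by rw [← hQ', hS, ← hj]; simp⟩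

theorem mem_span_iff {n : ℕ+} {g : RatField} (hg : g ∈ polySub n) (a : polySub n) :
    a ∈ Ideal.span {(⟨g, hg⟩ : polySub n)} ↔ ∃ c ∈ polySub n, g * c = a := by
  rw [Ideal.mem_span_singleton']
  constructor
  · rintro ⟨c, hc⟩
    exact ⟨c, c.2, by rw [← hc, mul_comm]; rfl⟩
  · rintro ⟨c, hc, h⟩
    exact ⟨⟨c, hc⟩, Subtype.ext ((mul_comm _ _).trans h)⟩

theorem span_gen_isPrime {n : ℕ+} {j : Option ℕ+} (hj : trunc n j = gen n j)
    (hg : gen n j ∈ polySub n) : (Ideal.span {(⟨gen n j, hg⟩ : polySub n)}).IsPrime := by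
  refine ⟨fun htop => ?_, fun {a b} hab => ?_⟩
  · obtain ⟨c, hc, h⟩ := (mem_span_iff hg 1).1 (htop ▸ Submodule.mem_top)
    obtain ⟨Q, hQ, -⟩ := lift_fixed (n := n) (m := n) (r := gen n) (fun _ _ => rfl)
      ⟨X none, by simp [gen], by simp [gen]⟩ hc
    have h1 : X j * Q = 1 := gen_algebraicIndependent n (by simp [hQ, h])
    exact (X_prime (R := ℚ) (i := j)).not_isUnit (IsUnit.of_mul_eq_one _ h1)
  · obtain ⟨c, hc, h⟩ := (mem_span_iff hg _).1 hab
    rw [mem_span_iff, mem_span_iff]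
    exact gen_prime hj a.2 b.2 hc h

end Auxiliary

instance idealX_isPrime {n i : ℕ+} (hi : i ≤ n) : (idealX hi).IsPrime :=
  span_gen_isPrime (j := some i) (by simp [trunc, gen, hi]) (x_mem hi)

instance idealZ_isPrime (n : ℕ+) : (idealZ n).IsPrime :=
  span_gen_isPrime (j := none) rfl (z_mem n)

/-- The complement of `(x₁) ∪ ⋯ ∪ (xₙ) ∪ (y / (x₁ ⋯ xₙ))`. -/
def denominators (n : ℕ+) : Submonoid (polySub n) where
  carrier := {s | (∀ (i : ℕ+) (hi : i ≤ n), s ∉ idealX hi) ∧ s ∉ idealZ n}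
  one_mem' := ⟨fun _ hi => (idealX hi).primeCompl.one_mem, (idealZ n).primeCompl.one_mem⟩
  mul_mem' := fun ha hb => ⟨fun i hi => (idealX hi).primeCompl.mul_mem (ha.1 i hi) (hb.1 i hi),
    (idealZ n).primeCompl.mul_mem ha.2 hb.2⟩

theorem denominators_ne_zero {n : ℕ+} {s : polySub n} (hs : s ∈ denominators n) :
    (s : RatField) ≠ 0 := by
  intro h
  have h0 : s = 0 := Subtype.ext h
  exact hs.2 (h0 ▸ (idealZ n).zero_mem)

/-- The ring of fractions
`ℚ[x₁, …, xₙ, y / (x₁ ⋯ xₙ)]_{(x₁) ∪ ⋯ ∪ (xₙ) ∪ (y / (x₁ ⋯ xₙ))}`, inside `ℚ(y, x₁, x₂, …)`. -/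
def stage (n : ℕ+) : Subalgebra ℚ RatField where
  carrier := {f | ∃ a : polySub n, ∃ s ∈ denominators n, f = (a : RatField) / s}
  algebraMap_mem' r := ⟨algebraMap ℚ _ r, 1, one_mem _, by simp⟩
  mul_mem' := by
    rintro _ _ ⟨a, s, hs, rfl⟩ ⟨b, t, ht, rfl⟩
    exact ⟨a * b, s * t, mul_mem hs ht, by simp [div_mul_div_comm]⟩
  add_mem' := by
    rintro _ _ ⟨a, s, hs, rfl⟩ ⟨b, t, ht, rfl⟩
    exact ⟨a * t + s * b, s * t, mul_mem hs ht, by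
      simp [div_add_div _ _ (denominators_ne_zero hs) (denominators_ne_zero ht)]⟩

theorem polySub_le_stage (n : ℕ+) : polySub n ≤ stage n :=
  fun a ha => ⟨⟨a, ha⟩, 1, one_mem _, by simp⟩

theorem polySub_le_succ (n : ℕ+) : polySub n ≤ polySub (n + 1) := by
  refine Algebra.adjoin_le ?_
  rintro _ (⟨i, hi, rfl⟩ | rfl)
  · exact x_mem (hi.2.trans (PNat.lt_add_right n 1).le)
  · rw [z_eq]
    exact mul_mem (x_mem le_rfl) (z_mem _)

theorem denominators_succ {n : ℕ+} {s : polySub n} (hs : s ∈ denominators n) :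
    (⟨s, polySub_le_succ n s.2⟩ : polySub (n + 1)) ∈ denominators (n + 1) := by
  have hlt : ¬ n + 1 ≤ n := not_le.2 (PNat.lt_add_right n 1)
  -- a substitution with values in `polySub n` fixing `polySub n` pointwise
  let r (u v : RatField) (o : Option ℕ+) : RatField :=
    o.elim u fun i => if i ≤ n then x i else v
  have key : ∀ u ∈ polySub n, ∀ v ∈ polySub n, v * u = z n → ∀ j : Option ℕ+,
      ∀ c ∈ polySub (n + 1), gen (n + 1) j * c = s → ∃ d ∈ polySub n, r u v j * d = s := by
    intro u hu v hv huv j c hc h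
    refine div_descend (r := r u v) ?_ (fun i hi => by simp [r, hi]) ?_ s.2 hc j h
    · rintro (_ | i)
      · exact hu
      · by_cases hi : i ≤ n
        · simpa [r, hi] using x_mem hi
        · simpa [r, hi] using hv
    · exact ⟨X (some (n + 1)) * X none, by simp [gen, z_eq n], by simp [r, hlt, huv]⟩
  have key1 := key (z n) (z_mem n) 1 (one_mem _) (one_mul _)
  have key2 := key 1 (one_mem _) (z n) (z_mem n) (mul_one _)
  refine ⟨fun i hi hmem => ?_, fun hmem => ?_⟩
  · obtain ⟨c, hc, h⟩ := (mem_span_iff _ _).1 hmem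
    by_cases hin : i ≤ n
    · obtain ⟨d, hd, h'⟩ := key1 (some i) c hc h
      refine hs.1 i hin ((mem_span_iff _ _).2 ⟨d, hd, ?_⟩)
      simpa [r, hin] using h'
    · obtain ⟨d, hd, h'⟩ := key2 (some i) c hc h
      refine hs.2 ((mem_span_iff _ _).2 ⟨d, hd, ?_⟩)
      simpa [r, hin] using h'
  · obtain ⟨c, hc, h⟩ := (mem_span_iff _ _).1 hmem
    obtain ⟨d, hd, h'⟩ := key1 none c hc h
    exact hs.2 ((mem_span_iff _ _).2 ⟨d, hd, h'⟩)

theorem stage_le_succ (n : ℕ+) : stage n ≤ stage (n + 1) := by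
  rintro _ ⟨a, s, hs, rfl⟩
  exact ⟨⟨a, polySub_le_succ n a.2⟩, _, denominators_succ hs, rfl⟩

theorem stage_mono : Monotone stage := by
  intro m n h
  induction n using PNat.recOn with
  | one => rw [le_antisymm h one_le]
  | succ n ih =>
    rcases h.lt_or_eq with h | rfl
    · exact (ih (PNat.lt_add_one_iff.1 h)).trans (stage_le_succ n)
    · exact le_rfl

/-- The domain
`C = ⋃ₙ ℚ[x₁, …, xₙ, y / (x₁ ⋯ xₙ)]_{(x₁) ∪ ⋯ ∪ (xₙ) ∪ (y / (x₁ ⋯ xₙ))}`. -/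
def C : Subalgebra ℚ RatField where
  carrier := ⋃ n : ℕ+, (stage n : Set RatField)
  algebraMap_mem' r := Set.mem_iUnion.2 ⟨1, (stage 1).algebraMap_mem r⟩
  mul_mem' := by
    intro a b ha hb
    obtain ⟨m, ha⟩ := Set.mem_iUnion.1 ha
    obtain ⟨n, hb⟩ := Set.mem_iUnion.1 hb
    exact Set.mem_iUnion.2 ⟨max m n,
      mul_mem (stage_mono (le_max_left m n) ha) (stage_mono (le_max_right m n) hb)⟩
  add_mem' := by
    intro a b ha hb
    obtain ⟨m, ha⟩ := Set.mem_iUnion.1 ha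
    obtain ⟨n, hb⟩ := Set.mem_iUnion.1 hb
    exact Set.mem_iUnion.2 ⟨max m n,
      add_mem (stage_mono (le_max_left m n) ha) (stage_mono (le_max_right m n) hb)⟩

/-- `xₙ` as an element of `C`. -/
def xC (n : ℕ+) : C := ⟨x n, Set.mem_iUnion.2 ⟨n, polySub_le_stage n (x_mem le_rfl)⟩⟩

/-- `y / (x₁ ⋯ xₙ)` as an element of `C`. -/
def zC (n : ℕ+) : C := ⟨z n, Set.mem_iUnion.2 ⟨n, polySub_le_stage n (z_mem n)⟩⟩

/-- The ideal `N = ∑ₙ (y / (x₁ ⋯ xₙ)) C`. -/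
def N : Ideal C := Ideal.span (Set.range zC)

/-! ## The discrete valuation ring -/

/-- `K = ℚ(xₙ ; n ≥ 2)`. -/
abbrev K : Type := FractionRing (MvPolynomial {n : ℕ+ // 2 ≤ n} ℚ)

instance span_X_isPrime : (Ideal.span {(Polynomial.X : Polynomial K)}).IsPrime :=
  (Ideal.span_singleton_prime Polynomial.X_ne_zero).2 Polynomial.prime_X

/-- `K[t]_{(t)}` inside the rational function field `K(t)`. -/
def localRing : Subring (RatFunc K) :=
  (Localization.subalgebra.ofField (RatFunc K) (Ideal.span {(Polynomial.X : Polynomial K)}).primeCompl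
    (Ideal.primeCompl_le_nonZeroDivisors _)).toSubring

end ExampleC

end

/-! The rings `C` and `A` are both intersections of valuation rings of the rational function field,
and everything is read off from the values. For each `i` there is a monomial valuation in which `xᵢ`
and `y` have weight one and the other variables weight zero; the `y`-adic valuation is their limit,
since a given element has the same value at it and at all but finitely many of the others
(`exists_forall_val_eq`). Cancelling common prime factors of fractions shows that `C` consists of
the elements nonnegative at all these places (`mem_C_iff`). For `A`, only the place of `x₁` changes:
it is refined to a rank-two valuation with values in lexicographic `ℤ × ℤ`, in which `x₁` has value
`(1, 0)` and `y / x₁` has value `(0, 1)`. The parameter `ε` is 0 for `C` and 1 for `A`, and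
`IsValRing` treats both together.

The main tool is `exists_val_add_mul_le`: given `f` and `g`, some combination `f + τ g` with `τ` in
the ring has at every place a value at most those of `f` and `g`. One takes `τ = x_m + z_m` with `m`
beyond all variables involved; after clearing denominators the three terms have different degrees in
`x_m`, so nothing cancels. Hence the ring is Bezout and, by the limit property, membership in an
ideal can be tested one place at a time (`mem_of_forall_exists_le`). In particular the maximal
ideals are exactly the centers of the places, and an ideal is determined by its values.

At a discrete place a nonzero ideal `I` has a least value `n(o)`. The radical ideals of elements
vanishing where `n(o) ≥ k`, for `k = 1, 2, …`, multiply to an ideal with the same values; only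
finitely many `k` matter because one nonzero element of `I` has bounded values. This makes `C` an
SP-domain. It is not Dedekind because a generator of `N` would vanish at almost all places, whereas
`z_n` is a unit at the place of `x_n`.

At the rank-two place of `A` there are two cases. If `I` attains a least value there, it looks like
the unit ideal or like a principal ideal times the center. Otherwise it looks like a principal ideal
times the height-one prime `deep`. The generators can be chosen to be units at all other places, so
multiplying by the layers for the discrete places gives an ISP factorization. The chain `0 < deep <
center` gives dimension two, and an element vanishing at all discrete places lies in infinitely many
maximal ideals, so `A` is not h-local.

Finally, the substitution `x₁ ↦ 0`, `y / x₁ ↦ t` gives `C / x₁C ≅ K(t)`. The rank-two valuation is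
the composite of the `x₁`-place with the `t`-adic valuation, so it is nonnegative on an element of
`C` exactly when the residue lies in `K[t]_(t)` (`apply_mem_localRing_iff`). This identifies the
pullback with `A`. -/

noncomputable section

namespace ExampleC

open MvPolynomial

set_option linter.unusedSectionVars false

/-! ### Monomial valuations on polynomial rings and their fraction fields -/

section MonomialOrder

variable {σ R Γ : Type*} [CommRing R] [IsDomain R]
  [AddCommGroup Γ] [LinearOrder Γ] [IsOrderedAddMonoid Γ]

/-- The least `w`-weight of a monomial of `P`. -/
def weightOrder (w : σ → Γ) (P : MvPolynomial σ R) : WithTop Γ :=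
  P.support.inf fun α => ((Finsupp.weight w α : Γ) : WithTop Γ)

theorem le_weightOrder_iff {w : σ → Γ} {P : MvPolynomial σ R} {c : WithTop Γ} :
    c ≤ weightOrder w P ↔ ∀ α ∈ P.support, c ≤ ((Finsupp.weight w α : Γ) : WithTop Γ) :=
  Finset.le_inf_iff

theorem weightOrder_le {w : σ → Γ} {P : MvPolynomial σ R} {α : σ →₀ ℕ} (h : α ∈ P.support) :
    weightOrder w P ≤ ((Finsupp.weight w α : Γ) : WithTop Γ) :=
  Finset.inf_le h

theorem exists_weightOrder_eq (w : σ → Γ) {P : MvPolynomial σ R} (hP : P ≠ 0) :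
    ∃ α ∈ P.support, weightOrder w P = ((Finsupp.weight w α : Γ) : WithTop Γ) :=
  Finset.exists_mem_eq_inf _ (support_nonempty.2 hP) _

/-- The lowest weighted homogeneous components of the two factors have a nonzero product because
polynomials over a domain form a domain, and this product is the component of weight `a + b` of `P *
Q`. -/
theorem weightOrder_mul (w : σ → Γ) (P Q : MvPolynomial σ R) :
    weightOrder w (P * Q) = weightOrder w P + weightOrder w Q := by
  classical
  by_cases hP : P = 0
  · simp [hP, weightOrder]
  by_cases hQ : Q = 0
  · simp [hQ, weightOrder]
  obtain ⟨α₀, hα₀, ha⟩ := exists_weightOrder_eq w hP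
  obtain ⟨β₀, hβ₀, hb⟩ := exists_weightOrder_eq w hQ
  set a := Finsupp.weight w α₀ with ha'
  set b := Finsupp.weight w β₀ with hb'
  have hPa : ∀ α ∈ P.support, a ≤ Finsupp.weight w α := fun α h =>
    WithTop.coe_le_coe.1 (ha ▸ weightOrder_le h)
  have hQb : ∀ β ∈ Q.support, b ≤ Finsupp.weight w β := fun β h =>
    WithTop.coe_le_coe.1 (hb ▸ weightOrder_le h)
  rw [ha, hb, ← WithTop.coe_add]
  apply le_antisymm
  · have hne : weightedHomogeneousComponent w a P * weightedHomogeneousComponent w b Q ≠ 0 := by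
      refine mul_ne_zero (fun h => ?_) fun h => ?_
      · have := congrArg (coeff α₀) h
        rw [coeff_weightedHomogeneousComponent, if_pos rfl, coeff_zero] at this
        exact mem_support_iff.1 hα₀ this
      · have := congrArg (coeff β₀) h
        rw [coeff_weightedHomogeneousComponent, if_pos rfl, coeff_zero] at this
        exact mem_support_iff.1 hβ₀ this
    obtain ⟨γ, hγ⟩ := ne_zero_iff.1 hne
    have hw : Finsupp.weight w γ = a + b :=
      (((weightedHomogeneousComponent_isWeightedHomogeneous a P).mul
        (weightedHomogeneousComponent_isWeightedHomogeneous b Q)) hγ)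
    -- Only pairs of exponents of weight exactly `a` and `b` contribute: neither factor has
    -- monomials of smaller weight, so a larger weight in one could not be compensated in the other.
    have hc : coeff γ (P * Q)
        = coeff γ (weightedHomogeneousComponent w a P * weightedHomogeneousComponent w b Q) := by
      rw [coeff_mul, coeff_mul]
      refine Finset.sum_congr rfl fun x hx => ?_
      rw [coeff_weightedHomogeneousComponent, coeff_weightedHomogeneousComponent]
      rw [Finset.HasAntidiagonal.mem_antidiagonal] at hx
      rw [← hx, map_add] at hw
      by_cases h1 : x.1 ∈ P.support
      · by_cases h2 : x.2 ∈ Q.support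
        · have e1 := hPa _ h1
          have e2 := hQb _ h2
          have e3 : Finsupp.weight w x.1 = a := by
            apply le_antisymm _ e1
            by_contra! hlt
            exact absurd hw (add_lt_add_of_lt_of_le hlt e2).ne'
          have e4 : Finsupp.weight w x.2 = b := by
            rw [e3] at hw
            exact add_left_cancel hw
          rw [if_pos e3, if_pos e4]
        · simp [notMem_support_iff.1 h2]
      · simp [notMem_support_iff.1 h1]
    rw [← hw]
    exact weightOrder_le (mem_support_iff.2 (hc ▸ hγ))
  · rw [le_weightOrder_iff]
    intro γ hγ
    obtain ⟨α, hα, β, hβ, rfl⟩ := Finset.mem_add.1 (support_mul P Q hγ)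
    rw [map_add]
    exact WithTop.coe_le_coe.2 (add_le_add (hPa α hα) (hQb β hβ))

theorem le_weightOrder_add (w : σ → Γ) (P Q : MvPolynomial σ R) :
    min (weightOrder w P) (weightOrder w Q) ≤ weightOrder w (P + Q) := by
  classical
  rw [le_weightOrder_iff]
  intro α hα
  rcases Finset.mem_union.1 (support_add hα) with h | h
  · exact (min_le_left _ _).trans (weightOrder_le h)
  · exact (min_le_right _ _).trans (weightOrder_le h)

theorem weightOrder_monomial (w : σ → Γ) (α : σ →₀ ℕ) {c : R} (hc : c ≠ 0) :
    weightOrder w (monomial α c) = ((Finsupp.weight w α : Γ) : WithTop Γ) := by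
  classical
  simp [weightOrder, support_monomial, hc]

/-- `weightOrder w` as an additive valuation. -/
def weightVal (R : Type*) [CommRing R] [IsDomain R] (w : σ → Γ) :
    AddValuation (MvPolynomial σ R) (WithTop Γ) :=
  AddValuation.of (weightOrder w) (by simp [weightOrder])
    (by simpa using weightOrder_monomial (R := R) w 0 one_ne_zero)
    (le_weightOrder_add w) (weightOrder_mul w)

theorem weightVal_apply (w : σ → Γ) (P : MvPolynomial σ R) :
    weightVal R w P = weightOrder w P := rfl

theorem weightVal_X (w : σ → Γ) (o : σ) : weightVal R w (X o) = (w o : WithTop Γ) := by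
  rw [weightVal_apply, X, weightOrder_monomial w _ one_ne_zero]
  simp [Finsupp.weight_single]

theorem weightVal_ne_top (w : σ → Γ) {P : MvPolynomial σ R} (hP : P ≠ 0) :
    weightVal R w P ≠ ⊤ := by
  obtain ⟨α, -, h⟩ := exists_weightOrder_eq w hP
  rw [weightVal_apply, h]
  exact WithTop.coe_ne_top

theorem nonZeroDivisors_le_weightVal_supp (w : σ → Γ) :
    nonZeroDivisors (MvPolynomial σ R) ≤
      (AddValuation.toValuation (weightVal R w)).supp.primeCompl :=
  fun _ hP h => weightVal_ne_top w (nonZeroDivisors.ne_zero hP) h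

/-- The extension of `weightVal` to the field of fractions. -/
def fracWeightVal (R : Type*) [CommRing R] [IsDomain R] (w : σ → Γ) :
    AddValuation (FractionRing (MvPolynomial σ R)) (WithTop Γ) :=
  AddValuation.ofValuation ((AddValuation.toValuation (weightVal R w)).extendToLocalization
    (nonZeroDivisors_le_weightVal_supp w) (FractionRing (MvPolynomial σ R)))

theorem fracWeightVal_algebraMap (w : σ → Γ) (P : MvPolynomial σ R) :
    fracWeightVal R w (algebraMap _ _ P) = weightOrder w P :=
  (AddValuation.toValuation (weightVal R w)).extendToLocalization_apply_map_apply
    (nonZeroDivisors_le_weightVal_supp w) _ P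

end MonomialOrder

/-! ### Monomial valuations in the coordinates `z n, x₁, x₂, …` -/

section CoordinateChange

variable {Γ : Type*} [AddCommGroup Γ] [LinearOrder Γ] [IsOrderedAddMonoid Γ]

theorem prod_x_ne_zero (n : ℕ+) : ∏ i ∈ Finset.Icc 1 n, x i ≠ 0 :=
  Finset.prod_ne_zero_iff.2 fun i _ => x_ne_zero i

/-- Each factor `z n` becomes `y` once multiplied by `x₁ ⋯ xₙ`. -/
theorem aeval_gen_monomial (n : ℕ+) (α : Option ℕ+ →₀ ℕ) :
    aeval (gen n) (monomial α (1 : ℚ)) * (∏ i ∈ Finset.Icc 1 n, x i) ^ α none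
      = algebraMap Poly RatField (monomial α 1) := by
  induction α using Finsupp.induction_linear with
  | zero => simp
  | add α β hα hβ =>
    have h : (monomial (α + β) (1 : ℚ)) = monomial α 1 * monomial β 1 := by
      rw [monomial_mul, one_mul]
    rw [h, map_mul, map_mul, ← hα, ← hβ, Finsupp.add_apply, pow_add]
    ring
  | single o k =>
    have h : (monomial (Finsupp.single o k) (1 : ℚ)) = X o ^ k := by
      rw [X_pow_eq_monomial]
    rw [h, map_pow, map_pow, aeval_X]
    cases o with
    | none =>
      rw [Finsupp.single_eq_same, ← mul_pow]
      congr 1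
      exact div_mul_cancel₀ _ (prod_x_ne_zero n)
    | some i => simp [gen, x]

theorem algebraMap_C (q : ℚ) :
    algebraMap Poly RatField (MvPolynomial.C q) = algebraMap ℚ RatField q :=
  RingHom.congr_fun (Subsingleton.elim
    ((algebraMap Poly RatField).comp MvPolynomial.C) (algebraMap ℚ RatField)) q

theorem algebraMap_X_some (i : ℕ+) : algebraMap Poly RatField (X (some i)) = x i := rfl

/-- A monomial valuation in the coordinates `y, xᵢ` is monomial in the coordinates `z n, xᵢ`. -/
theorem fracWeightVal_aeval_gen {w w' : Option ℕ+ → Γ} {n : ℕ+}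
    (hsome : ∀ i, w' (some i) = w (some i))
    (hnone : w' none + ∑ i ∈ Finset.Icc 1 n, w (some i) = w none) (P : Poly) :
    fracWeightVal ℚ w (aeval (gen n) P) = weightOrder w' P := by
  classical
  by_cases hP : P = 0
  · simp [hP, weightOrder]
  set μ : Option ℕ+ →₀ ℕ := ∑ i ∈ Finset.Icc 1 n, Finsupp.single (some i) 1 with hμ
  set s : Γ := ∑ i ∈ Finset.Icc 1 n, w (some i) with hs
  have hμw : Finsupp.weight w μ = s := by
    simp [hμ, hs, map_sum, Finsupp.weight_single]
  have hμm : monomial μ (1 : ℚ) = ∏ i ∈ Finset.Icc 1 n, X (some i) := by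
    rw [hμ, monomial_sum_one]
    rfl
  have hμn : μ none = 0 := by
    simp [hμ, Finsupp.finsetSum_apply]
  set m : RatField := ∏ i ∈ Finset.Icc 1 n, x i with hm
  have hmm : algebraMap Poly RatField (monomial μ 1) = m := by
    rw [hμm, map_prod]
    rfl
  have hww : ∀ α : Option ℕ+ →₀ ℕ, Finsupp.weight w' α + α none • s = Finsupp.weight w α := by
    intro α
    induction α using Finsupp.induction_linear with
    | zero => simp
    | add α β hα hβ =>
      rw [map_add, map_add, ← hα, ← hβ, Finsupp.add_apply, add_smul]
      abel
    | single o k =>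
      cases o with
      | none => simp [Finsupp.weight_single, ← hnone]
      | some i => simp [Finsupp.weight_single, hsome]
  -- `D` is the degree of `P` in the variable standing for `z n`, so multiplying by `m ^ D` clears
  -- all denominators.
  set D := P.support.sup fun α => α none with hD
  have hle : ∀ α ∈ P.support, α none ≤ D := fun α h => Finset.le_sup (f := fun α => α none) h
  -- Clearing denominators sends the monomial `α` to the monomial `φ α`. As `μ` does not involve
  -- `y`, the exponent of `y` survives and `φ` is injective; distinct monomials therefore stay
  -- distinct and no cancellation occurs.
  set φ : (Option ℕ+ →₀ ℕ) → (Option ℕ+ →₀ ℕ) := fun α => α + (D - α none) • μ with hφ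
  have hinj : Function.Injective φ := by
    intro α β h
    have h0 : α none = β none := by
      have := DFunLike.congr_fun h none
      simpa [hφ, hμn] using this
    simpa [hφ, h0] using h
  set Q : Poly := ∑ α ∈ P.support, monomial (φ α) (coeff α P) with hQ
  have hcoeff : ∀ α ∈ P.support, coeff (φ α) Q = coeff α P := by
    intro α hα
    rw [hQ, coeff_sum, Finset.sum_eq_single α]
    · simp
    · intro β _ hβ
      rw [coeff_monomial, if_neg fun h => hβ (hinj h)]
    · exact fun h => absurd hα h
  have hsupp : ∀ γ ∈ Q.support, ∃ α ∈ P.support, γ = φ α := by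
    intro γ hγ
    by_contra! hcon
    refine mem_support_iff.1 hγ ?_
    rw [hQ, coeff_sum]
    exact Finset.sum_eq_zero fun α hα => by rw [coeff_monomial, if_neg fun h => hcon α hα h.symm]
  have hφw : ∀ α ∈ P.support, Finsupp.weight w (φ α) = Finsupp.weight w' α + D • s := by
    intro α hα
    rw [hφ]
    simp only [map_add, map_nsmul]
    rw [hμw, ← hww α, add_assoc, ← add_smul, Nat.add_sub_cancel' (hle α hα)]
  have hval : weightOrder w Q = weightOrder w' P + ((D • s : Γ) : WithTop Γ) := by
    apply le_antisymm
    · obtain ⟨α, hα, h⟩ := exists_weightOrder_eq w' hP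
      rw [h, ← WithTop.coe_add, ← hφw α hα]
      exact weightOrder_le (mem_support_iff.2 (by rw [hcoeff α hα]; exact mem_support_iff.1 hα))
    · rw [le_weightOrder_iff]
      intro γ hγ
      obtain ⟨α, hα, rfl⟩ := hsupp γ hγ
      rw [hφw α hα, WithTop.coe_add]
      gcongr
      exact weightOrder_le hα
  have hmap : aeval (gen n) P * m ^ D = algebraMap Poly RatField Q := by
    conv_lhs => rw [P.as_sum]
    rw [map_sum, Finset.sum_mul, hQ, map_sum]
    refine Finset.sum_congr rfl fun α hα => ?_
    have e1 : ∀ β : Option ℕ+ →₀ ℕ, monomial β (coeff α P)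
        = MvPolynomial.C (coeff α P) * monomial β (1 : ℚ) := fun β => by
      rw [C_mul_monomial, mul_one]
    have e2 : monomial (φ α) (1 : ℚ) = monomial α 1 * monomial μ 1 ^ (D - α none) := by
      rw [monomial_pow, monomial_mul, one_pow, one_mul]
    rw [e1, e1, e2, map_mul, map_mul, map_mul, map_pow, hmm, ← aeval_gen_monomial n α]
    rw [← Nat.add_sub_cancel' (hle α hα), pow_add]
    have e3 : aeval (gen n) (MvPolynomial.C (coeff α P))
        = algebraMap Poly RatField (MvPolynomial.C (coeff α P)) := by
      rw [← algebraMap_eq, AlgHom.commutes]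
      exact (algebraMap_C _).symm
    rw [e3, Nat.add_sub_cancel' (hle α hα)]
    ring
  have hvm : fracWeightVal ℚ w (m ^ D) = ((D • s : Γ) : WithTop Γ) := by
    rw [← hmm, ← map_pow, fracWeightVal_algebraMap, monomial_pow, one_pow,
      weightOrder_monomial _ _ one_ne_zero, map_nsmul, hμw]
  have := congrArg (fracWeightVal ℚ w) hmap
  rw [AddValuation.map_mul, fracWeightVal_algebraMap, hvm, hval] at this
  exact WithTop.add_right_cancel WithTop.coe_ne_top this

end CoordinateChange

/-! ## The valuations -/

/-- The value group `ℤ × ℤ`, ordered lexicographically. -/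
abbrev ValGroup : Type := ℤ ×ₗ ℤ

/-- The element `(1, 0)` of the value group. -/
def big : ValGroup := toLex (1, 0)

/-- The element `(0, 1)` of the value group. -/
def small : ValGroup := toLex (0, 1)

theorem toLex_eq (k l : ℤ) : (toLex (k, l) : ValGroup) = k • big + l • small := by
  refine ofLex.injective (Prod.ext ?_ ?_)
  · show k = (k • (1 : ℤ)) + l • (0 : ℤ)
    simp
  · show l = (k • (0 : ℤ)) + l • (1 : ℤ)
    simp

theorem exists_eq_zsmul_add (γ : ValGroup) : ∃ k l : ℤ, γ = k • big + l • small :=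
  ⟨(ofLex γ).1, (ofLex γ).2, toLex_eq _ _⟩

theorem zsmul_add_le_iff {k l k' l' : ℤ} :
    k • big + l • small ≤ k' • big + l' • small ↔ k < k' ∨ k = k' ∧ l ≤ l' := by
  rw [← toLex_eq, ← toLex_eq, Prod.Lex.toLex_le_toLex]

theorem zsmul_add_lt_iff {k l k' l' : ℤ} :
    k • big + l • small < k' • big + l' • small ↔ k < k' ∨ k = k' ∧ l < l' := by
  rw [← toLex_eq, ← toLex_eq, Prod.Lex.toLex_lt_toLex]

theorem small_pos : 0 < small := by
  have := @zsmul_add_lt_iff 0 0 0 1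
  simpa using this

theorem nsmul_small_lt_big (n : ℕ) : n • small < big := by
  have := @zsmul_add_lt_iff 0 n 1 0
  simpa using this

theorem big_pos : 0 < big := by simpa using nsmul_small_lt_big 0

/-- `small` is the least positive element of the lexicographic group; this lets the condition of
positive value be written as `small ≤ value`. -/
theorem small_le_of_pos {γ : ValGroup} (h : 0 < γ) : small ≤ γ := by
  obtain ⟨k, l, rfl⟩ := exists_eq_zsmul_add γ
  have h1 := @zsmul_add_lt_iff 0 0 k l
  have h2 := @zsmul_add_le_iff 0 1 k l
  simp only [zero_smul, zero_add, one_smul] at h1 h2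
  rw [h1] at h
  rw [h2]
  omega

/-- The weights of the variables at the place `o`; `none` is the `y`-adic place and `some i` is
the place at which `xᵢ` and `y` have weight one. At `some 1` the weight of `y` is modified
by `ε • small`. -/
def placeWeight (ε : ℕ) : Option ℕ+ → Option ℕ+ → ValGroup
  | none, none => big
  | none, some _ => 0
  | some i, none => if i = 1 then big + ε • small else big
  | some i, some j => if i = j then big else 0

/-- The monomial valuation at a place. -/
def val (ε : ℕ) (o : Option ℕ+) : AddValuation RatField (WithTop ValGroup) :=
  fracWeightVal ℚ (placeWeight ε o)

/-- The weights of `z n, x₁, x₂, …` at a place. -/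
def genWeight (ε : ℕ) (n : ℕ+) (o : Option ℕ+) : Option ℕ+ → ValGroup
  | none => match o with
    | none => big
    | some i => if i ≤ n then (if i = 1 then ε • small else 0) else big
  | some j => placeWeight ε o (some j)

theorem val_aeval_gen (ε : ℕ) (n : ℕ+) (o : Option ℕ+) (P : Poly) :
    val ε o (aeval (gen n) P) = weightOrder (genWeight ε n o) P := by
  refine fracWeightVal_aeval_gen (Γ := ValGroup) (w := placeWeight ε o)
    (w' := genWeight ε n o) (fun i => rfl) ?_ P
  cases o with
  | none => simp [genWeight, placeWeight]
  | some i =>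
    simp only [genWeight, placeWeight, Finset.sum_ite_eq, Finset.mem_Icc]
    by_cases hi : i ≤ n
    · by_cases h1 : i = 1
      · simp [h1, add_comm]
      · simp [h1, hi, one_le]
    · have h1 : i ≠ 1 := fun h => hi (h ▸ one_le)
      simp [h1, hi]

theorem val_algebraMap (ε : ℕ) (o : Option ℕ+) (P : Poly) :
    val ε o (algebraMap Poly RatField P) = weightOrder (placeWeight ε o) P :=
  fracWeightVal_algebraMap _ _

theorem val_x (ε : ℕ) (o : Option ℕ+) (j : ℕ+) :
    val ε o (x j) = (placeWeight ε o (some j) : WithTop ValGroup) := by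
  rw [x, val_algebraMap, ← weightVal_apply, weightVal_X]

theorem val_y (ε : ℕ) (o : Option ℕ+) :
    val ε o y = (placeWeight ε o none : WithTop ValGroup) := by
  rw [y, val_algebraMap, ← weightVal_apply, weightVal_X]

theorem val_z (ε : ℕ) (o : Option ℕ+) (n : ℕ+) :
    val ε o (z n) = (genWeight ε n o none : WithTop ValGroup) := by
  have := val_aeval_gen ε n o (X none)
  rwa [aeval_X, ← weightVal_apply, weightVal_X] at this

theorem val_algebraMap_rat (ε : ℕ) (o : Option ℕ+) (q : ℚ) :
    0 ≤ val ε o (algebraMap ℚ RatField q) := by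
  by_cases hq : q = 0
  · simp [hq]
  · rw [← algebraMap_C, val_algebraMap, ← monomial_zero', weightOrder_monomial _ _ hq]
    simp

theorem placeWeight_nonneg (ε : ℕ) (o j : Option ℕ+) : 0 ≤ placeWeight ε o j := by
  rcases o with _ | i <;> rcases j with _ | j <;> simp only [placeWeight]
  · exact big_pos.le
  · exact le_rfl
  · split_ifs
    · exact add_nonneg big_pos.le (nsmul_nonneg small_pos.le _)
    · exact big_pos.le
  · split_ifs
    · exact big_pos.le
    · exact le_rfl

theorem genWeight_nonneg (ε : ℕ) (n : ℕ+) (o j : Option ℕ+) : 0 ≤ genWeight ε n o j := by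
  rcases j with _ | j
  · rcases o with _ | i <;> simp only [genWeight]
    · exact big_pos.le
    · split_ifs
      · exact nsmul_nonneg small_pos.le _
      · exact le_rfl
      · exact big_pos.le
  · exact placeWeight_nonneg ε o (some j)

theorem val_nonneg_of_mem_polySub (ε : ℕ) (o : Option ℕ+) {n : ℕ+} {a : RatField}
    (ha : a ∈ polySub n) : 0 ≤ val ε o a := by
  induction ha using Algebra.adjoin_induction with
  | mem a h =>
    rcases h with ⟨i, -, rfl⟩ | rfl
    · rw [val_x]
      exact WithTop.coe_nonneg.2 (placeWeight_nonneg _ _ _)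
    · rw [val_z]
      exact WithTop.coe_nonneg.2 (genWeight_nonneg _ _ _ _)
  | algebraMap c => exact val_algebraMap_rat ε o c
  | add a b _ _ ha hb => exact AddValuation.map_le_add _ ha hb
  | mul a b _ _ ha hb =>
    rw [AddValuation.map_mul]
    exact add_nonneg ha hb

theorem val_ne_top (ε : ℕ) (o : Option ℕ+) {f : RatField} (hf : f ≠ 0) : val ε o f ≠ ⊤ :=
  (AddValuation.ne_top_iff _).2 hf

/-- A nonzero element divides another one at a place iff its value is smaller. -/
theorem val_le_val_iff (ε : ℕ) (o : Option ℕ+) {f h : RatField} (hh : h ≠ 0) :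
    val ε o h ≤ val ε o f ↔ 0 ≤ val ε o (f / h) := by
  have h1 : val ε o f = val ε o (f / h) + val ε o h := by
    rw [← AddValuation.map_mul, div_mul_cancel₀ _ hh]
  rw [h1]
  obtain ⟨c, hc⟩ := WithTop.ne_top_iff_exists.1 (val_ne_top ε o hh)
  rw [← hc]
  generalize val ε o (f / h) = d
  cases d with
  | top => simp
  | coe d =>
    rw [← WithTop.coe_add, WithTop.coe_le_coe, WithTop.coe_nonneg]
    exact le_add_iff_nonneg_left c

theorem gen_ne_zero (n : ℕ+) (o : Option ℕ+) : gen n o ≠ 0 :=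
  (gen_algebraicIndependent n).ne_zero o

/-- The equation `trunc n o = gen n o` is the uniform way of saying that `o` is `none` or `some i`
with `i ≤ n`, that is, a place visible in `polySub n`. For larger `i` it would force `x i = 1`. -/
theorem le_of_trunc_some {n i : ℕ+} (ho : trunc n (some i) = gen n (some i)) : i ≤ n := by
  by_contra hi
  have h1 : (1 : RatField) = x i := by simpa [trunc, gen, hi] using ho
  have h2 := val_x 0 (some i) i
  rw [← h1, AddValuation.map_one] at h2
  exact big_pos.ne (by simpa [placeWeight] using WithTop.coe_injective h2)

/-- In `polySub n`, an element of positive value at a place `o` is divisible by `gen n o`. -/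
theorem exists_gen_mul_eq {n : ℕ+} {o : Option ℕ+} (ho : trunc n o = gen n o)
    {s : RatField} (hs : s ∈ polySub n) (hpos : 0 < val 0 o s) :
    ∃ c ∈ polySub n, gen n o * c = s := by
  have hr : ∀ j, trunc n j ∈ polySub n := by
    rintro (_ | i)
    · exact z_mem n
    · by_cases hi : i ≤ n
      · simpa [trunc, hi] using x_mem hi
      · simp [trunc, hi]
  obtain ⟨P, hP, hP'⟩ := lift_fixed (m := n) (r := trunc n) (fun i hi => by simp [trunc, hi])
    ⟨X none, by simp [gen], by simp [trunc]⟩ hs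
  rw [← hP, val_aeval_gen] at hpos
  -- At a visible place with `ε = 0`, only the generator `gen n o` has nonzero weight, so a positive
  -- value forces `X o` to occur in every monomial.
  have hw : ∀ j, j ≠ o → genWeight 0 n o j = 0 := by
    intro j hj
    rcases j with _ | j <;> rcases o with _ | i
    · exact absurd rfl hj
    · simp [genWeight, le_of_trunc_some ho]
    · rfl
    · simp only [genWeight, placeWeight]
      rw [if_neg]
      rintro rfl
      exact hj rfl
  have hdvd : X o ∣ P := by
    rw [P.as_sum]
    refine Finset.dvd_sum fun α hα => ?_
    rw [X_dvd_monomial]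
    right
    intro h0
    have h1 := hpos.trans_le (weightOrder_le hα)
    rw [Finsupp.weight_apply, Finsupp.sum, Finset.sum_eq_zero, WithTop.coe_zero] at h1
    · exact lt_irrefl _ h1
    · intro j _
      by_cases hj : j = o
      · rw [hj, h0, zero_smul]
      · rw [hw j hj]
        exact nsmul_zero _
  obtain ⟨S, hS⟩ := hdvd
  exact ⟨aeval (trunc n) S, aeval_mem hr S, by rw [← hP', hS, ← ho]; simp⟩

theorem trunc_some {n i : ℕ+} (hi : i ≤ n) : trunc n (some i) = gen n (some i) := by
  simp [trunc, gen, hi]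

theorem val_gen_pos {n : ℕ+} (o : Option ℕ+) : 0 < val 0 o (gen n o) := by
  rcases o with _ | i
  · show 0 < val 0 none (z n)
    rw [val_z]
    exact WithTop.coe_pos.2 big_pos
  · show 0 < val 0 (some i) (x i)
    rw [val_x]
    simpa [placeWeight] using WithTop.coe_pos.2 big_pos

theorem val_pos_iff_of_mem_polySub {n : ℕ+} {o : Option ℕ+} (ho : trunc n o = gen n o)
    {s : RatField} (hs : s ∈ polySub n) :
    0 < val 0 o s ↔ ∃ c ∈ polySub n, gen n o * c = s := by
  refine ⟨exists_gen_mul_eq ho hs, ?_⟩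
  rintro ⟨c, hc, rfl⟩
  rw [AddValuation.map_mul]
  exact add_pos_of_pos_of_nonneg (val_gen_pos o) (val_nonneg_of_mem_polySub 0 o hc)

/-- The primes defining the stage are the centers on `polySub n` of the visible places. -/
theorem mem_denominators_iff {n : ℕ+} {s : polySub n} :
    s ∈ denominators n ↔ ∀ o, trunc n o = gen n o → ¬ 0 < val 0 o (s : RatField) := by
  constructor
  · rintro ⟨h1, h2⟩ o ho hpos
    have h3 := exists_gen_mul_eq ho s.2 hpos
    rcases o with _ | i
    · exact h2 ((mem_span_iff _ _).2 h3)
    · exact h1 i (le_of_trunc_some ho) ((mem_span_iff _ _).2 h3)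
  · intro h
    refine ⟨fun i hi hmem => ?_, fun hmem => ?_⟩
    · exact h (some i) (trunc_some hi)
        ((val_pos_iff_of_mem_polySub (trunc_some hi) s.2).2 ((mem_span_iff _ _).1 hmem))
    · exact h none rfl ((val_pos_iff_of_mem_polySub (o := none) rfl s.2).2
        ((mem_span_iff _ _).1 hmem))

/-! ## `C` as an intersection of valuation rings -/

theorem polySub_mono : Monotone polySub := by
  intro m n h
  induction n using PNat.recOn with
  | one => rw [le_antisymm h one_le]
  | succ n ih =>
    rcases h.lt_or_eq with h | rfl
    · exact (ih (PNat.lt_add_one_iff.1 h)).trans (polySub_le_succ n)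
    · exact le_rfl

theorem y_eq : y = x 1 * z 1 := by
  have h : x 1 ≠ 0 := x_ne_zero 1
  unfold z
  simp only [Finset.Icc_self, Finset.prod_singleton]
  field_simp

theorem exists_algebraMap_mem_polySub (P : Poly) :
    ∃ n, ∀ m ≥ n, algebraMap Poly RatField P ∈ polySub m := by
  induction P using MvPolynomial.induction_on with
  | C a => exact ⟨1, fun m _ => by rw [algebraMap_C]; exact (polySub m).algebraMap_mem a⟩
  | add p q hp hq =>
    obtain ⟨n, hn⟩ := hp
    obtain ⟨k, hk⟩ := hq
    refine ⟨max n k, fun m hm => ?_⟩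
    rw [map_add]
    exact add_mem (hn m (le_of_max_le_left hm)) (hk m (le_of_max_le_right hm))
  | mul_X p i hp =>
    obtain ⟨n, hn⟩ := hp
    rcases i with _ | i
    · refine ⟨n, fun m hm => ?_⟩
      rw [map_mul]
      refine mul_mem (hn m hm) ?_
      show y ∈ polySub m
      rw [y_eq]
      exact polySub_mono one_le (mul_mem (x_mem le_rfl) (z_mem 1))
    · refine ⟨max n i, fun m hm => ?_⟩
      rw [map_mul]
      exact mul_mem (hn m (le_of_max_le_left hm)) (x_mem (le_of_max_le_right hm))

/-- If `b` is not an admissible denominator, it is divisible by some prime `gen n o`; so is `a`,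
whose value at `o` is at least that of `b`. Cancelling this prime lowers the degree of the
denominator, which gives the induction. -/
theorem div_mem_stage {n : ℕ+} (d : ℕ) : ∀ (P : Poly) (a b : RatField), a ∈ polySub n →
    b ∈ polySub n → aeval (gen n) P = b → P.totalDegree = d → b ≠ 0 →
    (∀ o, 0 ≤ val 0 o (a / b)) → a / b ∈ stage n := by
  induction d using Nat.strong_induction_on with
  | _ d ih =>
    intro P a b ha hb hP hd hb0 hval
    by_cases hden : (⟨b, hb⟩ : polySub n) ∈ denominators n
    · exact ⟨⟨a, ha⟩, ⟨b, hb⟩, hden, rfl⟩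
    · rw [mem_denominators_iff] at hden
      push Not at hden
      obtain ⟨o, ho, hpos⟩ := hden
      obtain ⟨c, hc, hcb⟩ := exists_gen_mul_eq ho hb hpos
      obtain ⟨c', hc', hca⟩ := exists_gen_mul_eq ho ha
        (hpos.trans_le ((val_le_val_iff 0 o hb0).2 (hval o)))
      obtain ⟨P', hP', -⟩ := lift_fixed (n := n) (m := n) (r := gen n) (fun _ _ => rfl)
        ⟨X none, by simp [gen], by simp [gen]⟩ hc
      have hPP : P' * X o = P := gen_algebraicIndependent n (by simp [hP, hP', ← hcb, mul_comm])
      have hc0 : c ≠ 0 := fun h => hb0 (by rw [← hcb, h, mul_zero])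
      have hP0 : P' ≠ 0 := fun h => hc0 (by rw [← hP', h, map_zero])
      have hdeg : P'.totalDegree < d := by
        rw [← hd, ← hPP, totalDegree_mul_of_isDomain hP0 (X_ne_zero o), totalDegree_X]
        exact Nat.lt_succ_self _
      have hdiv : a / b = c' / c := by
        rw [← hcb, ← hca, mul_div_mul_left _ _ (gen_ne_zero n o)]
      rw [hdiv] at hval ⊢
      exact ih _ hdeg P' c' c hc' hc hP' rfl hc0 hval

theorem mem_C_iff {f : RatField} : f ∈ C ↔ ∀ o, 0 ≤ val 0 o f := by
  constructor
  · intro hf o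
    obtain ⟨n, hn⟩ := Set.mem_iUnion.1 hf
    -- The stage is enlarged until the place `o` is visible.
    obtain ⟨m, hnm, hm⟩ : ∃ m ≥ n, trunc m o = gen m o := by
      rcases o with _ | i
      · exact ⟨n, le_rfl, rfl⟩
      · exact ⟨max n i, le_max_left _ _, trunc_some (le_max_right _ _)⟩
    obtain ⟨a, s, hs, rfl⟩ := stage_mono hnm hn
    rw [← val_le_val_iff 0 o (denominators_ne_zero hs)]
    exact (not_lt.1 (mem_denominators_iff.1 hs o hm)).trans (val_nonneg_of_mem_polySub 0 o a.2)
  · intro hf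
    obtain ⟨P, Q, hQ, rfl⟩ := IsFractionRing.div_surjective (A := Poly) f
    obtain ⟨n, hn⟩ := exists_algebraMap_mem_polySub P
    obtain ⟨k, hk⟩ := exists_algebraMap_mem_polySub Q
    have ha := hn (max n k) (le_max_left _ _)
    have hb := hk (max n k) (le_max_right _ _)
    obtain ⟨R, hR, -⟩ := lift_fixed (n := max n k) (m := max n k) (r := gen (max n k))
      (fun _ _ => rfl) ⟨X none, by simp [gen], by simp [gen]⟩ hb
    refine Set.mem_iUnion.2 ⟨max n k, div_mem_stage _ R _ _ ha hb hR rfl ?_ hf⟩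
    exact IsFractionRing.to_map_ne_zero_of_mem_nonZeroDivisors hQ

/-! ## Further properties of the valuations -/

theorem exists_forall_lt_notMem_vars (P : Poly) : ∃ n : ℕ+, ∀ i > n, some i ∉ P.vars := by
  obtain ⟨n, hn⟩ := Finset.exists_le (Finset.eraseNone P.vars)
  exact ⟨n, fun i hi hmem => absurd (hn i (Finset.mem_eraseNone.2 hmem)) (not_le.2 hi)⟩

theorem apply_eq_zero_of_notMem_vars {P : Poly} {o : Option ℕ+} (h : o ∉ P.vars)
    {α : Option ℕ+ →₀ ℕ} (hα : α ∈ P.support) : α o = 0 := by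
  by_contra h0
  exact h ((mem_vars_iff_mem_support o).2 ⟨α, hα, Finsupp.mem_support_iff.2 h0⟩)

/-- Once `xᵢ` does not occur in `P`, the places `some i` and `none` give the same weights to all
variables of `P`; `i ≠ 1` avoids the modified weight of `y`. -/
theorem exists_forall_val_algebraMap_eq (ε : ℕ) (P : Poly) : ∃ n : ℕ+, ∀ i > n,
    val ε (some i) (algebraMap Poly RatField P) = val ε none (algebraMap Poly RatField P) := by
  obtain ⟨n, hn⟩ := exists_forall_lt_notMem_vars P
  refine ⟨n, fun i hi => ?_⟩
  rw [val_algebraMap, val_algebraMap]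
  refine Finset.inf_congr rfl fun α hα => ?_
  rw [Finsupp.weight_apply, Finsupp.weight_apply]
  congr 1
  refine Finset.sum_congr rfl fun j hj => ?_
  have hi1 : i ≠ 1 := (lt_of_le_of_lt one_le hi).ne'
  rcases j with _ | j
  · simp [placeWeight, hi1]
  · by_cases hij : i = j
    · subst hij
      rw [apply_eq_zero_of_notMem_vars (hn i hi) hα]
      simp
    · simp [placeWeight, hij]

/-- Each element has the same value at almost all places. -/
theorem exists_forall_val_eq (ε : ℕ) (f : RatField) : ∃ n : ℕ+, ∀ i > n,
    val ε (some i) f = val ε none f := by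
  obtain ⟨P, Q, -, rfl⟩ := IsFractionRing.div_surjective (A := Poly) f
  obtain ⟨n, hn⟩ := exists_forall_val_algebraMap_eq ε P
  obtain ⟨k, hk⟩ := exists_forall_val_algebraMap_eq ε Q
  refine ⟨max n k, fun i hi => ?_⟩
  rw [AddValuation.map_div, AddValuation.map_div, hn i (lt_of_le_of_lt (le_max_left _ _) hi),
    hk i (lt_of_le_of_lt (le_max_right _ _) hi)]

theorem val_mul_le_val_mul_iff (ε : ℕ) (o : Option ℕ+) {f h c : RatField} (hc : c ≠ 0) :
    val ε o (f * c) ≤ val ε o (h * c) ↔ val ε o f ≤ val ε o h := by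
  rw [AddValuation.map_mul, AddValuation.map_mul]
  exact WithTop.add_le_add_iff_right (val_ne_top ε o hc)

theorem forall_support_mul {P Q : Poly} {o : Option ℕ+} {k l : ℕ}
    (hP : ∀ α ∈ P.support, α o = k) (hQ : ∀ α ∈ Q.support, α o = l) :
    ∀ α ∈ (P * Q).support, α o = k + l := by
  classical
  intro γ hγ
  obtain ⟨α, hα, β, hβ, rfl⟩ := Finset.mem_add.1 (support_mul P Q hγ)
  rw [Finsupp.add_apply, hP α hα, hQ β hβ]

theorem weightOrder_add_le {P Q : Poly} (h : ∀ α ∈ P.support, α ∉ Q.support)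
    (w : Option ℕ+ → ValGroup) : weightOrder w (P + Q) ≤ weightOrder w P := by
  rw [le_weightOrder_iff]
  intro α hα
  refine weightOrder_le (mem_support_iff.2 ?_)
  rw [coeff_add, notMem_support_iff.1 (h α hα), add_zero]
  exact mem_support_iff.1 hα

/-- Different degrees in `v` keep the three supports disjoint, so no monomial of a summand can
cancel. -/
theorem val_add_add_le (ε : ℕ) (o : Option ℕ+) {v : Option ℕ+} {P Q R : Poly}
    (hP : ∀ α ∈ P.support, α v = 0) (hQ : ∀ α ∈ Q.support, α v = 1)
    (hR : ∀ α ∈ R.support, α v = 2) :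
    val ε o (algebraMap Poly RatField (P + Q + R)) ≤ val ε o (algebraMap Poly RatField P) ∧
    val ε o (algebraMap Poly RatField (P + Q + R)) ≤ val ε o (algebraMap Poly RatField Q) ∧
    val ε o (algebraMap Poly RatField (P + Q + R)) ≤ val ε o (algebraMap Poly RatField R) := by
  classical
  simp only [val_algebraMap]
  refine ⟨?_, ?_, ?_⟩
  · rw [add_assoc]
    refine weightOrder_add_le (fun α h h' => ?_) _
    have h0 := hP α h
    rcases Finset.mem_union.1 (support_add h') with h' | h'
    · have := hQ α h'
      omega
    · have := hR α h'
      omega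
  · rw [add_comm P, add_assoc]
    refine weightOrder_add_le (fun α h h' => ?_) _
    have h0 := hQ α h
    rcases Finset.mem_union.1 (support_add h') with h' | h'
    · have := hP α h'
      omega
    · have := hR α h'
      omega
  · rw [add_comm]
    refine weightOrder_add_le (fun α h h' => ?_) _
    have h0 := hR α h
    rcases Finset.mem_union.1 (support_add h') with h' | h'
    · have := hP α h'
      omega
    · have := hQ α h'
      omega

/-- For all `f` and `g` there is a linear combination having the least possible value at
all places. -/
theorem exists_val_add_mul_le (ε : ℕ) (f g : RatField) : ∃ τ : RatField,
    (∀ o, 0 ≤ val ε o τ) ∧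
      ∀ o, val ε o (f + τ * g) ≤ val ε o f ∧ val ε o (f + τ * g) ≤ val ε o g := by
  obtain ⟨⟨b, hb⟩, hab⟩ := IsLocalization.exist_integer_multiples_of_finset
    (nonZeroDivisors Poly) {f, g}
  obtain ⟨a, ha⟩ := hab f (by simp)
  obtain ⟨a', ha'⟩ := hab g (by simp)
  rw [Algebra.smul_def] at ha ha'
  simp only at ha ha'
  -- With `b` a common denominator, `a = b f` and `a' = b g`; the index `m` is chosen so that `x m`
  -- occurs in neither numerator.
  obtain ⟨n₁, hn₁⟩ := exists_forall_lt_notMem_vars a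
  obtain ⟨n₂, hn₂⟩ := exists_forall_lt_notMem_vars a'
  set n := max n₁ n₂ with hn
  set m := n + 1 with hm
  have hnm : n < m := PNat.lt_add_right n 1
  have hm1 : m ≠ 1 := (lt_of_le_of_lt one_le hnm).ne'
  set M : Poly := ∏ i ∈ Finset.Icc 1 n, X (some i) with hM
  have hM' : algebraMap Poly RatField M = ∏ i ∈ Finset.Icc 1 n, x i := by
    rw [hM, map_prod]
    rfl
  have hzn : z n * algebraMap Poly RatField M = y := by
    rw [hM']
    exact div_mul_cancel₀ _ (prod_x_ne_zero n)
  have hda : ∀ α ∈ a.support, α (some m) = 0 := fun α hα =>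
    apply_eq_zero_of_notMem_vars (hn₁ m (lt_of_le_of_lt (le_max_left _ _) hnm)) hα
  have hda' : ∀ α ∈ a'.support, α (some m) = 0 := fun α hα =>
    apply_eq_zero_of_notMem_vars (hn₂ m (lt_of_le_of_lt (le_max_right _ _) hnm)) hα
  have hdX : ∀ (o : Option ℕ+), ∀ α ∈ (X o : Poly).support,
      α (some m) = if o = some m then 1 else 0 := by
    classical
    intro o α hα
    rw [support_X, Finset.mem_singleton] at hα
    rw [hα, Finsupp.single_apply]
  have hdM : ∀ α ∈ M.support, α (some m) = 0 := by
    have : ∀ s : Finset ℕ+, m ∉ s → ∀ α ∈ (∏ i ∈ s, X (some i) : Poly).support,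
        α (some m) = 0 := by
      intro s
      induction s using Finset.induction_on with
      | empty =>
        intro _ α hα
        rw [Finset.prod_empty, support_one, Finset.mem_singleton] at hα
        simp [hα]
      | insert i s hi ih =>
        intro hms
        rw [Finset.mem_insert, not_or] at hms
        rw [Finset.prod_insert hi]
        have h1 := hdX (some i)
        rw [if_neg (fun h => hms.1 (Option.some_injective _ h).symm)] at h1
        exact forall_support_mul h1 (ih hms.2)
    exact this _ fun h => absurd (Finset.mem_Icc.1 h).2 (not_le.2 hnm)
  have hdm := hdX (some m)
  rw [if_pos rfl] at hdm
  have hdn := hdX none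
  rw [if_neg (by simp)] at hdn
  have hle := fun o => val_add_add_le ε o (forall_support_mul hda' hdn)
    (forall_support_mul (forall_support_mul hda hdM) hdm)
    (forall_support_mul (forall_support_mul (forall_support_mul hda' hdM) hdm) hdm)
  set c : RatField := algebraMap Poly RatField b * algebraMap Poly RatField M * x m with hc
  have hc0 : c ≠ 0 := by
    refine mul_ne_zero (mul_ne_zero ?_ ?_) (x_ne_zero m)
    · exact IsFractionRing.to_map_ne_zero_of_mem_nonZeroDivisors hb
    · rw [hM']
      exact prod_x_ne_zero n
  have hzm : z m * (algebraMap Poly RatField M * x m) = y := by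
    rw [← hzn, z_eq n]
    ring
  -- For `τ = x m + z m`, multiplication by `c = b x₁ ⋯ xₙ x_m` turns the summands `z m * g`, `f`,
  -- `x m * g` into polynomials of degree 0, 1, 2 in `x m`.
  have hsum : algebraMap Poly RatField (a' * X none + a * M * X (some m)
      + a' * M * X (some m) * X (some m)) = (f + (x m + z m) * g) * c := by
    simp only [map_add, map_mul, algebraMap_X_some, ha, ha']
    change _ * g * y + _ + _ = _
    rw [← hzm, hc]
    ring
  rw [hsum] at hle
  refine ⟨x m + z m, fun o => ?_, fun o => ⟨?_, ?_⟩⟩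
  · exact val_nonneg_of_mem_polySub ε o (add_mem (x_mem le_rfl) (z_mem m))
  · rw [← val_mul_le_val_mul_iff ε o hc0]
    refine (hle o).2.1.trans (le_of_eq (congrArg (val ε o) ?_))
    simp only [map_mul, algebraMap_X_some, ha]
    rw [hc]
    ring
  · rw [← val_mul_le_val_mul_iff ε o hc0]
    -- At each place one of the summands `z m * g` and `x m * g` has the same value as `g`: `z m` is
    -- a unit at `some m`, because `m ≠ 1`, and `x m` is a unit everywhere else.
    by_cases ho : o = some m
    · refine (hle o).1.trans (le_of_eq ?_)
      have h0 : val ε o (z m) = 0 := by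
        rw [val_z, ho]
        simp [genWeight, hm1]
      have h1 : algebraMap Poly RatField (a' * X none) = z m * (g * c) := by
        rw [map_mul, ha']
        change _ * y = _
        rw [← hzm, hc]
        ring
      rw [h1, AddValuation.map_mul, h0, zero_add]
    · refine (hle o).2.2.trans (le_of_eq ?_)
      have h0 : val ε o (x m) = 0 := by
        rw [val_x]
        rcases o with _ | i
        · simp [placeWeight]
        · have : i ≠ m := fun h => ho (h ▸ rfl)
          simp [placeWeight, this]
      have h1 : algebraMap Poly RatField (a' * M * X (some m) * X (some m)) = g * c * x m := by
        simp only [map_mul, algebraMap_X_some, ha']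
        rw [hc]
        ring
      rw [h1, AddValuation.map_mul, h0, add_zero]

/-! ## Rings defined by the valuations -/

/-- A place is regular if its values are multiples of `big`. -/
def IsRegularPlace (ε : ℕ) (o : Option ℕ+) : Prop := ε = 0 ∨ o ≠ some 1

/-- All variables have weight 0 or `big` at a regular place, so the valuation is discrete of rank
one. -/
theorem IsRegularPlace.exists_zsmul {ε : ℕ} {o : Option ℕ+} (ho : IsRegularPlace ε o)
    {f : RatField} (hf : f ≠ 0) :
    ∃ k : ℤ, val ε o f = ((k • big : ValGroup) : WithTop ValGroup) := by
  have hw : ∀ j, placeWeight ε o j ∈ AddSubgroup.zmultiples big := by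
    intro j
    have h1 : big ∈ AddSubgroup.zmultiples big := AddSubgroup.mem_zmultiples big
    rcases o with _ | i <;> rcases j with _ | j <;> simp only [placeWeight]
    · exact h1
    · exact zero_mem _
    · split_ifs with h
      · rcases ho with ho | ho
        · simp [ho, h1]
        · exact absurd (congrArg some h) ho
      · exact h1
    · split_ifs
      · exact h1
      · exact zero_mem _
  have key : ∀ P : Poly, P ≠ 0 → ∃ k : ℤ, val ε o (algebraMap Poly RatField P)
      = ((k • big : ValGroup) : WithTop ValGroup) := by
    intro P hP
    obtain ⟨α, -, h⟩ := exists_weightOrder_eq (placeWeight ε o) hP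
    have : Finsupp.weight (placeWeight ε o) α ∈ AddSubgroup.zmultiples big := by
      rw [Finsupp.weight_apply]
      exact sum_mem fun i _ => nsmul_mem (hw i) _
    obtain ⟨k, hk⟩ := AddSubgroup.mem_zmultiples_iff.1 this
    exact ⟨k, by rw [val_algebraMap, h, hk]⟩
  obtain ⟨P, Q, hQ, rfl⟩ := IsFractionRing.div_surjective (A := Poly) f
  have hP : P ≠ 0 := by
    rintro rfl
    simp at hf
  obtain ⟨k, hk⟩ := key P hP
  obtain ⟨l, hl⟩ := key Q (nonZeroDivisors.ne_zero hQ)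
  exact ⟨k - l, by rw [AddValuation.map_div, hk, hl, sub_smul]; rfl⟩

theorem zsmul_big_le_iff {k l : ℤ} : k • big ≤ l • big ↔ k ≤ l :=
  zsmul_le_zsmul_iff_left big_pos

theorem zsmul_big_lt_iff {k l : ℤ} : k • big < l • big ↔ k < l :=
  zsmul_lt_zsmul_iff_left big_pos

theorem IsRegularPlace.exists_nsmul {ε : ℕ} {o : Option ℕ+} (ho : IsRegularPlace ε o)
    {f : RatField} (hf : f ≠ 0) (h0 : 0 ≤ val ε o f) :
    ∃ k : ℕ, val ε o f = ((k • big : ValGroup) : WithTop ValGroup) := by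
  obtain ⟨k, hk⟩ := ho.exists_zsmul hf
  rw [hk, WithTop.coe_nonneg, ← zero_smul ℤ big, zsmul_big_le_iff] at h0
  lift k to ℕ using h0
  exact ⟨k, by rw [hk, natCast_zsmul]⟩

theorem IsRegularPlace.big_le {ε : ℕ} {o : Option ℕ+} (ho : IsRegularPlace ε o)
    {f : RatField} (h0 : 0 < val ε o f) : (big : WithTop ValGroup) ≤ val ε o f := by
  by_cases hf : f = 0
  · simp [hf]
  obtain ⟨k, hk⟩ := ho.exists_zsmul hf
  rw [hk, WithTop.coe_pos, ← zero_smul ℤ big, zsmul_big_lt_iff] at h0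
  rw [hk, WithTop.coe_le_coe]
  nth_rw 1 [← one_smul ℤ big]
  rw [zsmul_big_le_iff]
  omega

/-- The element `x₁ + y / x₁`. -/
def pivot : RatField := x 1 + z 1

/-- At every place the two summands have different values, so the smaller one wins: `z 1` at `some
1`, and the unit `x 1` elsewhere. Thus the pivot is a unit of `C`, while for `ε = 1` it has the
least positive value at `some 1`. -/
theorem val_pivot (ε : ℕ) (o : Option ℕ+) :
    val ε o pivot = ((if o = some 1 then ε • small else 0 : ValGroup) : WithTop ValGroup) := by
  have h1 := val_x ε o 1
  have h2 := val_z ε o 1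
  unfold pivot
  rcases o with _ | i
  · simp only [placeWeight, genWeight] at h1 h2
    rw [AddValuation.map_add_eq_of_lt_left, h1]
    · simp
    · rw [h1, h2]
      exact WithTop.coe_lt_coe.2 big_pos
  · by_cases hi : i = 1
    · subst hi
      simp only [placeWeight, genWeight, le_refl, if_true] at h1 h2
      rw [AddValuation.map_add_eq_of_lt_right, h2]
      · simp
      · rw [h1, h2]
        exact WithTop.coe_lt_coe.2 (nsmul_small_lt_big _)
    · have hi' : ¬ i ≤ 1 := fun h => hi (le_antisymm h one_le)
      simp only [placeWeight, genWeight, hi, hi', if_false] at h1 h2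
      rw [AddValuation.map_add_eq_of_lt_left, h1]
      · simp [hi]
      · rw [h1, h2]
        exact WithTop.coe_lt_coe.2 big_pos

theorem val_x_of_ne (ε : ℕ) {o : Option ℕ+} {i : ℕ+} (h : o ≠ some i) : val ε o (x i) = 0 := by
  rw [val_x]
  rcases o with _ | j
  · rfl
  · have : j ≠ i := fun hj => h (congrArg some hj)
    simp [placeWeight, this]

theorem val_x_self (ε : ℕ) (i : ℕ+) : val ε (some i) (x i) = (big : WithTop ValGroup) := by
  rw [val_x]
  simp [placeWeight]

theorem val_z_one (ε : ℕ) (o : Option ℕ+) :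
    val ε o (z 1) = ((if o = some 1 then ε • small else big : ValGroup) : WithTop ValGroup) := by
  rw [val_z]
  rcases o with _ | i
  · simp [genWeight]
  · by_cases hi : i = 1
    · simp [genWeight, hi]
    · have hi' : ¬ i ≤ 1 := fun h => hi (le_antisymm h one_le)
      simp [genWeight, hi, hi']

theorem val_z_one_div_pivot (ε : ℕ) (o : Option ℕ+) :
    val ε o (z 1 / pivot) = ((if o = some 1 then 0 else big : ValGroup) : WithTop ValGroup) := by
  rw [AddValuation.map_div, val_z_one, val_pivot]
  split_ifs
  · exact congrArg _ (sub_self (ε • small))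
  · exact congrArg _ (sub_zero big)

open Classical in
-- For `ε = 0` the element `y` works. Otherwise `z 1` has value `big` except at `some 1`, where
-- dividing by the pivot makes it a unit.
theorem exists_val_eq_big (ε : ℕ) : ∃ u : RatField, ∀ o,
    val ε o u = ((if IsRegularPlace ε o then big else 0 : ValGroup) : WithTop ValGroup) := by
  by_cases hε : ε = 0
  · refine ⟨y, fun o => ?_⟩
    rw [val_y, if_pos (show IsRegularPlace ε o from Or.inl hε), hε]
    rcases o with _ | i
    · rfl
    · simp [placeWeight]
  · refine ⟨z 1 / pivot, fun o => ?_⟩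
    rw [val_z_one_div_pivot]
    by_cases ho : o = some 1
    · rw [if_pos ho, if_neg]
      rintro (h | h)
      · exact hε h
      · exact h ho
    · rw [if_neg ho, if_pos (show IsRegularPlace ε o from Or.inr ho)]

/-- `j` identifies `A` with the subring of elements that are nonnegative at all places. -/
structure IsValRing {A : Type*} [CommRing A] (ε : ℕ) (j : A →+* RatField) : Prop where
  injective : Function.Injective j
  nonneg : ∀ a o, 0 ≤ val ε o (j a)
  exists_eq : ∀ f, (∀ o, 0 ≤ val ε o f) → ∃ a, j a = f

namespace IsValRing

variable {A : Type*} [CommRing A] {ε : ℕ} {j : A →+* RatField}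

theorem map_ne_zero (h : IsValRing ε j) {a : A} (ha : a ≠ 0) : j a ≠ 0 :=
  (map_ne_zero_iff j h.injective).2 ha

theorem dvd (h : IsValRing ε j) {a b : A} (hab : ∀ o, val ε o (j a) ≤ val ε o (j b)) : a ∣ b := by
  by_cases ha : j a = 0
  · have := hab none
    rw [ha, AddValuation.map_zero, top_le_iff, AddValuation.top_iff] at this
    rw [h.injective (this.trans ha.symm)]
  · obtain ⟨c, hc⟩ := h.exists_eq (j b / j a) fun o => (val_le_val_iff ε o ha).1 (hab o)
    refine ⟨c, h.injective ?_⟩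
    rw [map_mul, hc, mul_div_cancel₀ _ ha]

theorem exists_mem_span_pair (h : IsValRing ε j) (a b : A) : ∃ c ∈ Ideal.span {a, b},
    ∀ o, val ε o (j c) ≤ val ε o (j a) ∧ val ε o (j c) ≤ val ε o (j b) := by
  obtain ⟨τ, h0, hτ⟩ := exists_val_add_mul_le ε (j a) (j b)
  obtain ⟨t, rfl⟩ := h.exists_eq τ h0
  refine ⟨a + t * b, Ideal.mem_span_pair.2 ⟨1, t, by rw [one_mul]⟩, fun o => ?_⟩
  rw [map_add, map_mul]
  exact hτ o

theorem isBezout (h : IsValRing ε j) : IsBezout A := by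
  rw [IsBezout.iff_span_pair_isPrincipal]
  intro a b
  obtain ⟨c, hc, hle⟩ := h.exists_mem_span_pair a b
  refine ⟨c, le_antisymm ?_ ?_⟩
  · rw [Ideal.span_le]
    rintro d (rfl | rfl)
    · exact Ideal.mem_span_singleton.2 (h.dvd fun o => (hle o).1)
    · exact Ideal.mem_span_singleton.2 (h.dvd fun o => (hle o).2)
  · rw [Ideal.submodule_span_eq, Ideal.span_singleton_le_iff_mem]
    exact hc

/-- Membership in an ideal can be tested place by place. -/
theorem mem_of_forall_exists_le (h : IsValRing ε j) {I : Ideal A} {f : A}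
    (hf : ∀ o, ∃ g ∈ I, val ε o (j g) ≤ val ε o (j f)) : f ∈ I := by
  classical
  obtain ⟨g₀, hg₀, hle₀⟩ := hf none
  obtain ⟨n₁, hn₁⟩ := exists_forall_val_eq ε (j g₀)
  obtain ⟨n₂, hn₂⟩ := exists_forall_val_eq ε (j f)
  -- Finitely many places are handled by repeatedly taking common divisors. Values never exceed
  -- those of `g₀`, which takes care of the remaining places: there `g₀` and `f` have their values
  -- at `none`.
  have key : ∀ s : Finset (Option ℕ+), ∃ c ∈ I, (∀ o, val ε o (j c) ≤ val ε o (j g₀)) ∧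
      ∀ o ∈ s, val ε o (j c) ≤ val ε o (j f) := by
    intro s
    induction s using Finset.induction_on with
    | empty => exact ⟨g₀, hg₀, fun o => le_rfl, by simp⟩
    | insert o s _ ih =>
      obtain ⟨c, hc, h1, h2⟩ := ih
      obtain ⟨g, hg, h3⟩ := hf o
      obtain ⟨d, hd, h4⟩ := h.exists_mem_span_pair c g
      refine ⟨d, (Ideal.span_le.2 ?_) hd, fun o => (h4 o).1.trans (h1 o), ?_⟩
      · rintro e (rfl | rfl)
        · exact hc
        · exact hg
      · intro o' ho'
        rcases Finset.mem_insert.1 ho' with rfl | ho'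
        · exact (h4 _).2.trans h3
        · exact (h4 _).1.trans (h2 _ ho')
  obtain ⟨c, hc, h1, h2⟩ := key (insert none ((Finset.Icc 1 (max n₁ n₂)).image some))
  refine I.mem_of_dvd (h.dvd fun o => ?_) hc
  rcases o with _ | i
  · exact h2 _ (by simp)
  · by_cases hi : i ≤ max n₁ n₂
    · exact h2 _ (Finset.mem_insert_of_mem (Finset.mem_image_of_mem _
        (Finset.mem_Icc.2 ⟨one_le, hi⟩)))
    · rw [not_le] at hi
      refine (h1 _).trans ?_
      rw [hn₁ i (lt_of_le_of_lt (le_max_left _ _) hi), hn₂ i (lt_of_le_of_lt (le_max_right _ _) hi)]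
      exact hle₀

theorem le_of_forall_exists_le (h : IsValRing ε j) {I J : Ideal A}
    (hIJ : ∀ f ∈ J, ∀ o, ∃ g ∈ I, val ε o (j g) ≤ val ε o (j f)) : J ≤ I :=
  fun f hf => h.mem_of_forall_exists_le (hIJ f hf)

/-- The ideal of elements of value at least `γ` at the place `o`. -/
def valIdeal (h : IsValRing ε j) (o : Option ℕ+) (γ : WithTop ValGroup) : Ideal A where
  carrier := {a | γ ≤ val ε o (j a)}
  zero_mem' := by simp
  add_mem' := fun ha hb => by
    rw [Set.mem_ofPred_eq, map_add]
    exact AddValuation.map_le_add _ ha hb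
  smul_mem' := fun c a ha => by
    rw [Set.mem_ofPred_eq, smul_eq_mul, map_mul, AddValuation.map_mul]
    exact le_add_of_nonneg_of_le (h.nonneg c o) ha

theorem mem_valIdeal (h : IsValRing ε j) {o : Option ℕ+} {γ : WithTop ValGroup} {a : A} :
    a ∈ h.valIdeal o γ ↔ γ ≤ val ε o (j a) := Iff.rfl

/-- The center of the place `o`. -/
def center (h : IsValRing ε j) (o : Option ℕ+) : Ideal A := h.valIdeal o small

theorem mem_center (h : IsValRing ε j) {o : Option ℕ+} {a : A} :
    a ∈ h.center o ↔ 0 < val ε o (j a) := by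
  rw [center, mem_valIdeal]
  refine ⟨fun ha => (WithTop.coe_pos.2 small_pos).trans_le ha, fun ha => ?_⟩
  generalize val ε o (j a) = c at ha
  cases c with
  | top => exact le_top
  | coe c => exact WithTop.coe_le_coe.2 (small_le_of_pos (WithTop.coe_pos.1 ha))

theorem notMem_center (h : IsValRing ε j) {o : Option ℕ+} {a : A} :
    a ∉ h.center o ↔ val ε o (j a) = 0 := by
  rw [mem_center, not_lt]
  exact ⟨fun ha => le_antisymm ha (h.nonneg a o), fun ha => ha.le⟩

theorem center_isPrime (h : IsValRing ε j) (o : Option ℕ+) : (h.center o).IsPrime := by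
  refine ⟨fun htop => ?_, fun {a b} hab => ?_⟩
  · have : (1 : A) ∉ h.center o := by
      rw [notMem_center, map_one, AddValuation.map_one]
    exact this (htop ▸ Submodule.mem_top)
  · by_contra! hcon
    rw [notMem_center, notMem_center] at hcon
    rw [mem_center, map_mul, AddValuation.map_mul, hcon.1, hcon.2, add_zero] at hab
    exact lt_irrefl _ hab

/-- Otherwise `I` contains at each place an element of value zero, and the place-by-place test puts
1 in `I`. -/
theorem exists_le_center (h : IsValRing ε j) {I : Ideal A} (hI : I ≠ ⊤) :
    ∃ o, I ≤ h.center o := by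
  by_contra! hcon
  refine hI ((Ideal.eq_top_iff_one I).2 (h.mem_of_forall_exists_le fun o => ?_))
  obtain ⟨g, hg, hgo⟩ := SetLike.not_le_iff_exists.1 (hcon o)
  exact ⟨g, hg, by rw [h.notMem_center.1 hgo]; exact h.nonneg _ _⟩

/-- Separating elements: `x i` vanishes only at `some i`; `z i` vanishes at `none` and not at `some
i` for `i ≠ 1`; for `i = 1` one uses `z 1 / pivot`, since `z 1` itself may have positive value at
`some 1`. -/
theorem eq_of_center_le (h : IsValRing ε j) {o o' : Option ℕ+} (ho : h.center o ≤ h.center o') :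
    o = o' := by
  by_contra hne
  rcases o with _ | i
  · obtain ⟨a, ha⟩ := h.exists_eq (z 1 / pivot) fun o => by
      rw [val_z_one_div_pivot, WithTop.coe_nonneg]
      split_ifs
      · exact le_rfl
      · exact big_pos.le
    rcases o' with _ | i
    · exact hne rfl
    · by_cases hi : i = 1
      · have h1 : a ∈ h.center none := by
          rw [mem_center, ha, val_z_one_div_pivot]
          simpa using WithTop.coe_pos.2 big_pos
        have h2 : a ∉ h.center (some i) := by
          rw [notMem_center, ha, val_z_one_div_pivot]
          simp [hi]
        exact h2 (ho h1)
      · obtain ⟨b, hb⟩ := h.exists_eq (z i) fun o => val_nonneg_of_mem_polySub _ _ (z_mem i)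
        have h1 : b ∈ h.center none := by
          rw [mem_center, hb, val_z]
          exact WithTop.coe_pos.2 big_pos
        have h2 : b ∉ h.center (some i) := by
          rw [notMem_center, hb, val_z]
          simp [genWeight, hi]
        exact h2 (ho h1)
  · obtain ⟨a, ha⟩ := h.exists_eq (x i) fun o => val_nonneg_of_mem_polySub _ _ (x_mem le_rfl)
    have h1 : a ∈ h.center (some i) := by
      rw [mem_center, ha, val_x_self]
      exact WithTop.coe_pos.2 big_pos
    have h2 : a ∉ h.center o' := by
      rw [notMem_center, ha, val_x_of_ne ε (Ne.symm hne)]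
    exact h2 (ho h1)

theorem center_isMaximal (h : IsValRing ε j) (o : Option ℕ+) : (h.center o).IsMaximal := by
  obtain ⟨M, hM, hoM⟩ := Ideal.exists_le_maximal _ (h.center_isPrime o).ne_top
  obtain ⟨o', ho'⟩ := h.exists_le_center hM.ne_top
  have := h.eq_of_center_le (hoM.trans ho')
  subst this
  rwa [le_antisymm hoM ho']

theorem isMaximal_iff (h : IsValRing ε j) {M : Ideal A} :
    M.IsMaximal ↔ ∃ o, M = h.center o := by
  refine ⟨fun hM => ?_, ?_⟩
  · obtain ⟨o, ho⟩ := h.exists_le_center hM.ne_top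
    exact ⟨o, hM.eq_of_le (h.center_isPrime o).ne_top ho⟩
  · rintro ⟨o, rfl⟩
    exact h.center_isMaximal o

/-- Membership in a prime below the center of `o` depends only on the value at `o`. Write `g = c s`
and `f ^ k = c t` with `c` in the ideal of both; then `s` has value zero at `o`, so `s ∉ P`, while
`s f ^ k = t g ∈ P`. -/
theorem mem_prime_of_le (h : IsValRing ε j) {P : Ideal A} (hP : P.IsPrime) {o : Option ℕ+}
    (ho : P ≤ h.center o) {g f : A} (hg : g ∈ P) (hg0 : g ≠ 0) {k : ℕ}
    (hk : val ε o (j g) ≤ val ε o (j (f ^ k))) : f ∈ P := by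
  obtain ⟨c, hc, hle⟩ := h.exists_mem_span_pair g (f ^ k)
  obtain ⟨s, hs⟩ := h.dvd fun o => (hle o).1
  obtain ⟨t, ht⟩ := h.dvd fun o => (hle o).2
  have hc' : val ε o (j g) ≤ val ε o (j c) := by
    rw [← h.mem_valIdeal]
    refine (Ideal.span_le.2 ?_) hc
    rintro e (rfl | rfl)
    · exact h.mem_valIdeal.2 le_rfl
    · exact hk
  have hsP : s ∉ P := by
    intro hsP
    have h1 := h.mem_center.1 (ho hsP)
    rw [hs, map_mul, AddValuation.map_mul] at hc'
    have hc0 : j c ≠ 0 := by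
      intro h0
      refine h.map_ne_zero hg0 ?_
      rw [hs, map_mul, h0, zero_mul]
    obtain ⟨d, hd⟩ := WithTop.ne_top_iff_exists.1 (val_ne_top ε o hc0)
    rw [← hd] at hc'
    generalize val ε o (j s) = e at h1 hc'
    cases e with
    | top => simp at hc'
    | coe e =>
      rw [← WithTop.coe_add, WithTop.coe_le_coe] at hc'
      exact absurd (WithTop.coe_pos.1 h1) (not_lt.2 (by simpa using hc'))
  have h2 : s * f ^ k ∈ P := by
    have : s * f ^ k = t * g := by
      rw [hs, ht]
      ring
    rw [this]
    exact P.mul_mem_left t hg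
  exact hP.mem_of_pow_mem k ((hP.mem_or_mem h2).resolve_left hsP)

theorem eq_center_of_isRegularPlace (h : IsValRing ε j) {P : Ideal A} (hP : P.IsPrime)
    (hP0 : P ≠ ⊥) {o : Option ℕ+} (hreg : IsRegularPlace ε o) (ho : P ≤ h.center o) :
    P = h.center o := by
  refine le_antisymm ho fun f hf => ?_
  obtain ⟨g, hg, hg0⟩ := Submodule.exists_mem_ne_zero_of_ne_bot hP0
  obtain ⟨k, hk⟩ := hreg.exists_nsmul (h.map_ne_zero hg0) (h.nonneg g o)
  refine h.mem_prime_of_le hP ho hg hg0 (k := k) ?_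
  rw [hk, map_pow, AddValuation.map_pow, WithTop.coe_nsmul]
  exact nsmul_le_nsmul_right (hreg.big_le (h.mem_center.1 hf)) k

end IsValRing

namespace IsValRing

variable {A : Type*} [CommRing A] {ε : ℕ} {j : A →+* RatField}

/-! ## Products of radical ideals -/

theorem valIdeal_big (h : IsValRing ε j) {o : Option ℕ+} (ho : IsRegularPlace ε o) :
    h.valIdeal o big = h.center o := by
  ext a
  rw [mem_center, mem_valIdeal]
  exact ⟨fun ha => (WithTop.coe_pos.2 big_pos).trans_le ha, ho.big_le⟩

/-- The radical ideal of elements vanishing at all regular places at which all elements of `I` have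
value at least `k`. -/
def layer (h : IsValRing ε j) (I : Ideal A) (k : ℕ) : Ideal A :=
  ⨅ (o : Option ℕ+) (_ : IsRegularPlace ε o)
    (_ : ∀ g ∈ I, ((k • big : ValGroup) : WithTop ValGroup) ≤ val ε o (j g)), h.valIdeal o big

theorem mem_layer (h : IsValRing ε j) {I : Ideal A} {k : ℕ} {f : A} : f ∈ h.layer I k ↔
    ∀ o, IsRegularPlace ε o →
      (∀ g ∈ I, ((k • big : ValGroup) : WithTop ValGroup) ≤ val ε o (j g)) →
        (big : WithTop ValGroup) ≤ val ε o (j f) := by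
  simp only [layer, Submodule.mem_iInf, mem_valIdeal]

theorem layer_isRadical (h : IsValRing ε j) (I : Ideal A) (k : ℕ) : (h.layer I k).IsRadical :=
  Ideal.isRadical_iInf _ fun o => Ideal.isRadical_iInf _ fun ho =>
    Ideal.isRadical_iInf _ fun _ => by
    rw [h.valIdeal_big ho]
    exact (h.center_isPrime o).isRadical

theorem exists_val_le_nsmul (f : RatField) (hf : f ≠ 0) (ε : ℕ) (o : Option ℕ+) :
    ∃ k : ℕ, val ε o f ≤ ((k • big : ValGroup) : WithTop ValGroup) := by
  obtain ⟨c, hc⟩ := WithTop.ne_top_iff_exists.1 (val_ne_top ε o hf)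
  obtain ⟨k, l, rfl⟩ := exists_eq_zsmul_add c
  -- One more than the first component, so that the lexicographic comparison holds whatever the
  -- second component is.
  refine ⟨(k + 1).toNat, ?_⟩
  rw [← hc, WithTop.coe_le_coe, ← natCast_zsmul, ← add_zero ((((k + 1).toNat : ℕ) : ℤ) • big),
    ← zero_smul ℤ small, zsmul_add_le_iff]
  left
  omega

/-- Only finitely many different values occur, by constancy at almost all places. -/
theorem exists_forall_val_le_nsmul (f : RatField) (hf : f ≠ 0) (ε : ℕ) :
    ∃ k : ℕ, ∀ o, val ε o f ≤ ((k • big : ValGroup) : WithTop ValGroup) := by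
  choose N hN using exists_val_le_nsmul f hf ε
  obtain ⟨n, hn⟩ := exists_forall_val_eq ε f
  have hmono : ∀ {a b : ℕ}, a ≤ b →
      ((a • big : ValGroup) : WithTop ValGroup) ≤ ((b • big : ValGroup) : WithTop ValGroup) :=
    fun hab => WithTop.coe_le_coe.2 (nsmul_le_nsmul_left big_pos.le hab)
  refine ⟨max (N none) ((Finset.Icc 1 n).sup fun i => N (some i)), fun o => ?_⟩
  rcases o with _ | i
  · exact (hN none).trans (hmono (le_max_left _ _))
  · by_cases hi : i ≤ n
    · refine (hN (some i)).trans (hmono (le_max_of_le_right ?_))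
      exact Finset.le_sup (f := fun i => N (some i)) (Finset.mem_Icc.2 ⟨one_le, hi⟩)
    · rw [hn i (not_le.1 hi)]
      exact (hN none).trans (hmono (le_max_left _ _))

theorem exists_val_eq_min (h : IsValRing ε j) {I : Ideal A} (hI : I ≠ ⊥) {o : Option ℕ+}
    (ho : IsRegularPlace ε o) : ∃ n : ℕ,
      (∃ g ∈ I, val ε o (j g) = ((n • big : ValGroup) : WithTop ValGroup)) ∧
      ∀ g ∈ I, ((n • big : ValGroup) : WithTop ValGroup) ≤ val ε o (j g) := by
  classical
  have hex : ∃ n : ℕ, ∃ g ∈ I, val ε o (j g) = ((n • big : ValGroup) : WithTop ValGroup) := by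
    obtain ⟨g, hg, hg0⟩ := Submodule.exists_mem_ne_zero_of_ne_bot hI
    obtain ⟨k, hk⟩ := ho.exists_nsmul (h.map_ne_zero hg0) (h.nonneg g o)
    exact ⟨k, g, hg, hk⟩
  refine ⟨Nat.find hex, Nat.find_spec hex, fun g hg => ?_⟩
  by_cases hg0 : g = 0
  · simp [hg0]
  obtain ⟨k, hk⟩ := ho.exists_nsmul (h.map_ne_zero hg0) (h.nonneg g o)
  rw [hk, WithTop.coe_le_coe]
  exact nsmul_le_nsmul_left big_pos.le (Nat.find_min' hex ⟨g, hg, hk⟩)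

theorem nsmul_big_le_iff {k l : ℕ} : k • big ≤ l • big ↔ k ≤ l := by
  rw [← natCast_zsmul, ← natCast_zsmul, zsmul_big_le_iff, Nat.cast_le]

theorem exists_mem_layer (h : IsValRing ε j) (I : Ideal A) :
    ∃ u : A, (∀ k, u ∈ h.layer I k) ∧
      (∀ o, IsRegularPlace ε o → val ε o (j u) = (big : WithTop ValGroup)) ∧
      ∀ o, ¬ IsRegularPlace ε o → val ε o (j u) = 0 := by
  classical
  obtain ⟨u, hu⟩ := exists_val_eq_big ε
  obtain ⟨u, rfl⟩ := h.exists_eq u fun o => by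
    rw [hu, WithTop.coe_nonneg]
    split_ifs
    · exact big_pos.le
    · exact le_rfl
  refine ⟨u, fun k => h.mem_layer.2 fun o ho _ => ?_, fun o ho => ?_, fun o ho => ?_⟩
  · rw [hu, if_pos ho]
  · rw [hu, if_pos ho]
  · rw [hu, if_neg ho, WithTop.coe_zero]

/-- A layer does not vanish outside its defining set of places. At `none`, the inequality for `g`
persists at almost all places, so the defining set lies in `{some 1, …, some n}` and `x₁ ⋯ xₙ` is in
the layer. At `some i`, the element `u / xᵢ` vanishes at all other regular places but not at `some
i`. -/
theorem exists_mem_layer_of_lt (h : IsValRing ε j) {I : Ideal A} {k : ℕ} {o : Option ℕ+}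
    (ho : IsRegularPlace ε o)
    (hk : ∃ g ∈ I, val ε o (j g) < ((k • big : ValGroup) : WithTop ValGroup)) :
    ∃ q ∈ h.layer I k, val ε o (j q) = 0 := by
  obtain ⟨g, hg, hgk⟩ := hk
  rcases o with _ | i
  · obtain ⟨n, hn⟩ := exists_forall_val_eq ε (j g)
    obtain ⟨q, hq⟩ := h.exists_eq (∏ i ∈ Finset.Icc 1 n, x i) fun o =>
      val_nonneg_of_mem_polySub ε o (prod_mem fun i hi => x_mem (Finset.mem_Icc.1 hi).2)
    refine ⟨q, h.mem_layer.2 fun o _ hoI => ?_, ?_⟩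
    · rcases o with _ | i
      · exact absurd (hoI g hg) (not_le.2 hgk)
      · have hi : i ≤ n := by
          by_contra hi
          refine absurd (hoI g hg) (not_le.2 ?_)
          rwa [hn i (not_le.1 hi)]
        rw [hq, ← Finset.mul_prod_erase _ _ (Finset.mem_Icc.2 ⟨one_le, hi⟩), AddValuation.map_mul,
          val_x_self]
        refine le_add_of_nonneg_right (val_nonneg_of_mem_polySub ε (n := n) _ ?_)
        exact prod_mem fun i hi => x_mem (Finset.mem_Icc.1 (Finset.mem_of_mem_erase hi)).2
    · rw [hq]
      have : ∀ s : Finset ℕ+, val ε none (∏ i ∈ s, x i) = 0 := by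
        intro s
        induction s using Finset.induction_on with
        | empty => simp
        | insert i s hi ih =>
          rw [Finset.prod_insert hi, AddValuation.map_mul, ih, val_x_of_ne ε (by simp), add_zero]
      exact this _
  · obtain ⟨u, hu, hu1, hu2⟩ := h.exists_mem_layer I
    have hx : x i ≠ 0 := x_ne_zero i
    have hval : ∀ o, o ≠ some i → val ε o (j u / x i) = val ε o (j u) := fun o hoi => by
      rw [AddValuation.map_div, val_x_of_ne ε hoi, sub_zero]
    have hval' : val ε (some i) (j u / x i) = 0 := by
      rw [AddValuation.map_div, val_x_self, hu1 _ ho]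
      exact congrArg _ (sub_self big)
    obtain ⟨q, hq⟩ := h.exists_eq (j u / x i) fun o => by
      by_cases hoi : o = some i
      · rw [hoi, hval']
      · rw [hval o hoi]
        exact h.nonneg u o
    refine ⟨q, h.mem_layer.2 fun o hor hoI => ?_, hq ▸ hval'⟩
    have hoi : o ≠ some i := by
      rintro rfl
      exact absurd (hoI g hg) (not_le.2 hgk)
    rw [hq, hval o hoi, hu1 o hor]

open Finset in
-- Each of the layers 1 to `n` contributes `big` at `o`. Together with `exists_mem_prod_layer`, this
-- shows that the least value at `o` of the product of the first `b` layers is `min b n • big`.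
theorem prod_layer_le (h : IsValRing ε j) {I : Ideal A} {o : Option ℕ+}
    (ho : IsRegularPlace ε o) {n : ℕ}
    (hn : ∀ g ∈ I, ((n • big : ValGroup) : WithTop ValGroup) ≤ val ε o (j g)) (b : ℕ) :
    ∏ k ∈ range b, h.layer I (k + 1) ≤ h.valIdeal o (((min b n) • big : ValGroup)) := by
  induction b with
  | zero =>
    intro a _
    rw [mem_valIdeal]
    simpa using h.nonneg a o
  | succ b ih =>
    rw [prod_range_succ, Ideal.mul_le]
    intro f hf q hq
    have h1 := ih hf
    rw [mem_valIdeal] at h1 ⊢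
    rw [map_mul, AddValuation.map_mul]
    by_cases hbn : b + 1 ≤ n
    · have h2 := h.mem_layer.1 hq o ho fun g hg => le_trans
        (WithTop.coe_le_coe.2 (nsmul_big_le_iff.2 hbn)) (hn g hg)
      rw [min_eq_left hbn, succ_nsmul, WithTop.coe_add]
      rw [min_eq_left (by omega)] at h1
      exact add_le_add h1 h2
    · rw [min_eq_right (by omega)]
      rw [min_eq_right (by omega)] at h1
      exact le_add_of_le_of_nonneg h1 (h.nonneg q o)

open Finset in
theorem exists_mem_prod_layer (h : IsValRing ε j) {I : Ideal A} {o : Option ℕ+}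
    (ho : IsRegularPlace ε o) {n : ℕ}
    (hn : ∃ g ∈ I, val ε o (j g) = ((n • big : ValGroup) : WithTop ValGroup)) (b : ℕ) :
    ∃ f ∈ ∏ k ∈ range b, h.layer I (k + 1),
      val ε o (j f) = ((min b n • big : ValGroup) : WithTop ValGroup) := by
  induction b with
  | zero => exact ⟨1, by simp, by simp⟩
  | succ b ih =>
    obtain ⟨f, hf, hfv⟩ := ih
    rw [prod_range_succ]
    by_cases hbn : b + 1 ≤ n
    · obtain ⟨u, hu, hu1, -⟩ := h.exists_mem_layer I
      refine ⟨f * u, Ideal.mul_mem_mul hf (hu _), ?_⟩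
      rw [map_mul, AddValuation.map_mul, hfv, hu1 o ho, min_eq_left hbn, min_eq_left (by omega),
        succ_nsmul, WithTop.coe_add]
    · obtain ⟨q, hq, hq0⟩ := h.exists_mem_layer_of_lt (I := I) (k := b + 1) ho (by
        obtain ⟨g, hg, hgn⟩ := hn
        refine ⟨g, hg, ?_⟩
        rw [hgn, WithTop.coe_lt_coe, ← not_le, nsmul_big_le_iff]
        exact hbn)
      refine ⟨f * q, Ideal.mul_mem_mul hf hq, ?_⟩
      rw [map_mul, AddValuation.map_mul, hfv, hq0, add_zero, min_eq_right (by omega),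
        min_eq_right (by omega)]

/-- At the regular places, each nonzero ideal has the same values as a product of
radical ideals. -/
theorem exists_prod_isRadical (h : IsValRing ε j) {I : Ideal A} (hI : I ≠ ⊥) :
    ∃ Q : Multiset (Ideal A), (∀ J ∈ Q, J.IsRadical) ∧
      (∀ o, IsRegularPlace ε o → ∀ f ∈ Q.prod, ∃ g ∈ I, val ε o (j g) ≤ val ε o (j f)) ∧
      (∀ o, IsRegularPlace ε o → ∀ g ∈ I, ∃ f ∈ Q.prod, val ε o (j f) ≤ val ε o (j g)) ∧
      ∀ o, ¬ IsRegularPlace ε o → ∃ f ∈ Q.prod, val ε o (j f) = 0 := by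
  obtain ⟨g₀, hg₀, hne⟩ := Submodule.exists_mem_ne_zero_of_ne_bot hI
  -- A bound for the values of one element of `I` bounds the least value of `I` at all places, so
  -- `b` layers suffice.
  obtain ⟨b, hb⟩ := exists_forall_val_le_nsmul (j g₀) (h.map_ne_zero hne) ε
  refine ⟨(Multiset.range b).map fun k => h.layer I (k + 1), ?_, ?_, ?_, ?_⟩
  · intro J hJ
    obtain ⟨k, -, rfl⟩ := Multiset.mem_map.1 hJ
    exact h.layer_isRadical I _
  all_goals intro o ho
  · obtain ⟨n, ⟨g, hg, hgn⟩, hmin⟩ := h.exists_val_eq_min hI ho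
    have hnb : n ≤ b := nsmul_big_le_iff.1 (WithTop.coe_le_coe.1 ((hmin _ hg₀).trans (hb o)))
    intro f hf
    have := h.prod_layer_le ho hmin b hf
    rw [mem_valIdeal, min_eq_right hnb] at this
    exact ⟨g, hg, hgn ▸ this⟩
  · obtain ⟨n, hn, hmin⟩ := h.exists_val_eq_min hI ho
    have hnb : n ≤ b := nsmul_big_le_iff.1 (WithTop.coe_le_coe.1 ((hmin _ hg₀).trans (hb o)))
    intro g hg
    obtain ⟨f, hf, hfv⟩ := h.exists_mem_prod_layer ho hn b
    rw [min_eq_right hnb] at hfv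
    exact ⟨f, hf, hfv ▸ hmin g hg⟩
  · obtain ⟨u, hu, -, hu2⟩ := h.exists_mem_layer I
    refine ⟨∏ k ∈ Finset.range b, u,
      Ideal.prod_mem_prod (s := Finset.range b) fun k _ => hu (k + 1), ?_⟩
    rw [Finset.prod_const, map_pow, AddValuation.map_pow, hu2 o ho, smul_zero]

end IsValRing

/-! ## The properties of `C` -/

theorem isValRing_C : IsValRing 0 (C.val : C →+* RatField) where
  injective := Subtype.val_injective
  nonneg a o := mem_C_iff.1 a.2 o
  exists_eq f hf := ⟨⟨f, mem_C_iff.2 hf⟩, rfl⟩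

theorem isRegularPlace_zero (o : Option ℕ+) : IsRegularPlace 0 o := Or.inl rfl

theorem isSPDomain_C : IsSPDomain C := by
  intro I
  by_cases hI : I = ⊥
  · refine ⟨{⊥}, fun J hJ => ?_, by simp [hI]⟩
    rw [Multiset.mem_singleton.1 hJ]
    exact Ideal.isPrime_bot.isRadical
  · obtain ⟨Q, hQ, h1, h2, -⟩ := isValRing_C.exists_prod_isRadical hI
    refine ⟨Q, hQ, le_antisymm ?_ ?_⟩
    · exact isValRing_C.le_of_forall_exists_le fun f hf o => h1 o (isRegularPlace_zero o) f hf
    · exact isValRing_C.le_of_forall_exists_le fun f hf o => h2 o (isRegularPlace_zero o) f hf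

theorem center_some (i : ℕ+) : isValRing_C.center (some i) = Ideal.span {xC i} := by
  ext a
  rw [IsValRing.mem_center, Ideal.mem_span_singleton]
  constructor
  · intro ha
    refine isValRing_C.dvd fun o => ?_
    change val 0 o (x i) ≤ _
    by_cases ho : o = some i
    · rw [ho, val_x_self]
      exact (isRegularPlace_zero _).big_le ha
    · rw [val_x_of_ne 0 ho]
      exact isValRing_C.nonneg a o
  · rintro ⟨b, rfl⟩
    rw [map_mul, AddValuation.map_mul]
    refine add_pos_of_pos_of_nonneg ?_ (isValRing_C.nonneg b _)
    change 0 < val 0 (some i) (x i)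
    rw [val_x_self]
    exact WithTop.coe_pos.2 big_pos

theorem val_z_none (ε : ℕ) (n : ℕ+) : val ε none (z n) = (big : WithTop ValGroup) := val_z ε none n

theorem val_z_self (n : ℕ+) : val 0 (some n) (z n) = 0 := by
  rw [val_z]
  simp [genWeight]

/-- Tested place by place: `z 1` has the least positive value at `none`, and `z i` is a unit at
`some i`. -/
theorem center_none : isValRing_C.center none = N := by
  apply le_antisymm
  · intro f hf
    refine isValRing_C.mem_of_forall_exists_le fun o => ?_
    rcases o with _ | i
    · refine ⟨zC 1, Ideal.subset_span ⟨1, rfl⟩, ?_⟩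
      change val 0 none (z 1) ≤ _
      rw [val_z_none]
      exact (isRegularPlace_zero _).big_le (isValRing_C.mem_center.1 hf)
    · refine ⟨zC i, Ideal.subset_span ⟨i, rfl⟩, ?_⟩
      change val 0 (some i) (z i) ≤ _
      rw [val_z_self]
      exact isValRing_C.nonneg f _
  · refine Ideal.span_le.2 ?_
    rintro _ ⟨n, rfl⟩
    refine isValRing_C.mem_center.2 ?_
    change 0 < val 0 none (z n)
    rw [val_z_none]
    exact WithTop.coe_pos.2 big_pos

theorem isMaximal_C_iff (M : Ideal C) :
    M.IsMaximal ↔ M = N ∨ ∃ n : ℕ+, M = Ideal.span {xC n} := by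
  rw [isValRing_C.isMaximal_iff]
  constructor
  · rintro ⟨_ | i, rfl⟩
    · exact Or.inl center_none
    · exact Or.inr ⟨i, center_some i⟩
  · rintro (rfl | ⟨i, rfl⟩)
    · exact ⟨none, center_none.symm⟩
    · exact ⟨some i, (center_some i).symm⟩

theorem xC_ne_zero (i : ℕ+) : xC i ≠ 0 := fun h => x_ne_zero i (congrArg Subtype.val h)

theorem ringKrullDim_C : ringKrullDim C = 1 := by
  apply le_antisymm
  · have : Ring.KrullDimLE 1 C := Ring.KrullDimLE.mk₁' fun I hI hP => by
      obtain ⟨o, ho⟩ := isValRing_C.exists_le_center hP.ne_top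
      rw [isValRing_C.eq_center_of_isRegularPlace hP hI (isRegularPlace_zero o) ho]
      exact isValRing_C.center_isMaximal o
    exact Ring.krullDimLE_iff.1 this
  · refine Order.one_le_krullDim_iff.2 ⟨⟨⊥, Ideal.isPrime_bot⟩,
      ⟨isValRing_C.center (some 1), isValRing_C.center_isPrime _⟩, ?_⟩
    change (⊥ : Ideal C) < isValRing_C.center (some 1)
    rw [bot_lt_iff_ne_bot, center_some, Ne, Ideal.span_singleton_eq_bot]
    exact xC_ne_zero 1

/-- In a Noetherian Bezout domain `N` would have a generator `f`. Being positive at `none`, `f` is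
positive at `some i` for all large `i`, contradicting that `z i ∈ N` has value zero there. -/
theorem not_isDedekindDomain_C : ¬ IsDedekindDomain C := by
  intro hD
  have := isValRing_C.isBezout
  obtain ⟨f, hf⟩ := IsBezout.isPrincipal_of_FG N
    ((isNoetherianRing_iff_ideal_fg C).1 inferInstance N)
  rw [Ideal.submodule_span_eq] at hf
  obtain ⟨n, hn⟩ := exists_forall_val_eq 0 (f : RatField)
  have h1 : 0 < val 0 none (f : RatField) := by
    refine isValRing_C.mem_center.1 ?_
    rw [center_none, hf]
    exact Ideal.mem_span_singleton_self f
  rw [← hn (n + 1) (PNat.lt_add_right n 1)] at h1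
  have h2 : zC (n + 1) ∈ N := Ideal.subset_span ⟨n + 1, rfl⟩
  rw [hf, Ideal.mem_span_singleton] at h2
  obtain ⟨g, hg⟩ := h2
  have h3 : z (n + 1) = f * g := congrArg Subtype.val hg
  have h4 := val_z_self (n + 1)
  rw [h3, AddValuation.map_mul] at h4
  exact (add_pos_of_pos_of_nonneg h1 (isValRing_C.nonneg g _)).ne' h4

/-! ## The rings with a place of rank two -/

theorem coe_nsmul_small_le_iff {m n : ℕ} :
    ((m • small : ValGroup) : WithTop ValGroup) ≤ ((n • small : ValGroup) : WithTop ValGroup)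
      ↔ m ≤ n := by
  rw [WithTop.coe_le_coe]
  exact nsmul_le_nsmul_iff_left small_pos

theorem isRegularPlace_of_ne {ε : ℕ} {o : Option ℕ+} (ho : o ≠ some 1) : IsRegularPlace ε o :=
  Or.inr ho

theorem not_isRegularPlace_one : ¬ IsRegularPlace 1 (some 1) := by
  rintro (h | h)
  · exact one_ne_zero h
  · exact h rfl

namespace IsValRing

variable {A : Type*} [CommRing A] {j : A →+* RatField}

/-- The elements whose value at `some 1` exceeds all multiples of `small`. -/
def deep (h : IsValRing 1 j) : Ideal A :=
  ⨅ n : ℕ, h.valIdeal (some 1) ((n • small : ValGroup))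

theorem mem_deep (h : IsValRing 1 j) {a : A} : a ∈ h.deep ↔
    ∀ n : ℕ, ((n • small : ValGroup) : WithTop ValGroup) ≤ val 1 (some 1) (j a) := by
  simp only [deep, Submodule.mem_iInf, mem_valIdeal]

theorem exists_val_eq (h : IsValRing 1 j) {a : A} (ha : a ≠ 0) (o : Option ℕ+) :
    ∃ k l : ℤ, 0 ≤ k ∧
      val 1 o (j a) = ((k • big + l • small : ValGroup) : WithTop ValGroup) := by
  obtain ⟨c, hc⟩ := WithTop.ne_top_iff_exists.1 (val_ne_top 1 o (h.map_ne_zero ha))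
  have h0 := h.nonneg a o
  obtain ⟨k, l, rfl⟩ := exists_eq_zsmul_add c
  refine ⟨k, l, ?_, hc.symm⟩
  rw [← hc, WithTop.coe_nonneg] at h0
  have := @zsmul_add_le_iff 0 0 k l
  simp only [zero_smul, zero_add] at this
  rw [this] at h0
  omega

/-- Exceeding all multiples of `small` means having a positive first component. -/
theorem mem_deep_iff_of_eq (h : IsValRing 1 j) {a : A} {k l : ℤ}
    (ha : val 1 (some 1) (j a) = ((k • big + l • small : ValGroup) : WithTop ValGroup)) :
    a ∈ h.deep ↔ 1 ≤ k := by
  rw [mem_deep, ha]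
  have : ∀ n : ℕ, ((n • small : ValGroup) : WithTop ValGroup)
      ≤ ((k • big + l • small : ValGroup) : WithTop ValGroup) ↔ 0 < k ∨ 0 = k ∧ (n : ℤ) ≤ l := by
    intro n
    rw [WithTop.coe_le_coe, ← zsmul_add_le_iff, zero_smul, zero_add, natCast_zsmul]
  simp only [this]
  refine ⟨fun hn => ?_, fun hk n => Or.inl (by omega)⟩
  have := hn (l + 1).toNat
  omega

theorem mem_deep_or (h : IsValRing 1 j) (a : A) : a ∈ h.deep ∨
    ∃ m : ℕ, val 1 (some 1) (j a) = ((m • small : ValGroup) : WithTop ValGroup) := by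
  by_cases ha : a = 0
  · exact Or.inl (ha ▸ zero_mem _)
  obtain ⟨k, l, hk, hkl⟩ := h.exists_val_eq ha (some 1)
  by_cases hk1 : 1 ≤ k
  · exact Or.inl ((h.mem_deep_iff_of_eq hkl).2 hk1)
  · right
    have hk0 : k = 0 := by omega
    subst hk0
    have h0 := h.nonneg a (some 1)
    rw [hkl, zero_smul, zero_add, WithTop.coe_nonneg] at h0
    have hl : 0 ≤ l := by
      rwa [← zero_smul ℤ small, zsmul_le_zsmul_iff_left small_pos] at h0
    lift l to ℕ using hl
    exact ⟨l, by rw [hkl, zero_smul, zero_add, natCast_zsmul]⟩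

theorem notMem_deep (h : IsValRing 1 j) {a : A} {m : ℕ}
    (ha : val 1 (some 1) (j a) = ((m • small : ValGroup) : WithTop ValGroup)) : a ∉ h.deep := by
  intro hmem
  have := h.mem_deep.1 hmem (m + 1)
  rw [ha, coe_nsmul_small_le_iff] at this
  omega

theorem deep_isPrime (h : IsValRing 1 j) : h.deep.IsPrime := by
  refine ⟨fun htop => ?_, fun {a b} hab => ?_⟩
  · have : (1 : A) ∉ h.deep := h.notMem_deep (m := 0) (by simp)
    exact this (htop ▸ Submodule.mem_top)
  · by_contra! hcon
    obtain ⟨m, hm⟩ := (h.mem_deep_or a).resolve_left hcon.1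
    obtain ⟨n, hn⟩ := (h.mem_deep_or b).resolve_left hcon.2
    refine h.notMem_deep (m := m + n) ?_ hab
    rw [map_mul, AddValuation.map_mul, hm, hn, ← WithTop.coe_add, add_smul]

/-- The place `some 1` takes every nonnegative value on elements that are units elsewhere. -/
theorem exists_val_one_eq (h : IsValRing 1 j) {γ : ValGroup} (hγ : 0 ≤ γ) :
    ∃ c : A, val 1 (some 1) (j c) = (γ : WithTop ValGroup) ∧
      ∀ o, o ≠ some 1 → val 1 o (j c) = 0 := by
  obtain ⟨k, l, rfl⟩ := exists_eq_zsmul_add γ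
  have hk : 0 ≤ k := by
    have := @zsmul_add_le_iff 0 0 k l
    simp only [zero_smul, zero_add] at this
    rw [this] at hγ
    omega
  have hp : val 1 (some 1) pivot = (small : WithTop ValGroup) := by
    rw [val_pivot, if_pos rfl, one_smul]
  have hp' : ∀ o, o ≠ some 1 → val 1 o pivot = 0 := fun o ho => by
    rw [val_pivot, if_neg ho, WithTop.coe_zero]
  -- At `some 1`, `x 1` has value `big` and the pivot has value `small`; both are units at the other
  -- places. The quotient of pivot powers covers both signs of `l`.
  set f : RatField := x 1 ^ k.toNat * (pivot ^ l.toNat / pivot ^ (-l).toNat) with hf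
  have h1 : val 1 (some 1) f = ((k • big + l • small : ValGroup) : WithTop ValGroup) := by
    rw [hf, AddValuation.map_mul, AddValuation.map_div, AddValuation.map_pow, AddValuation.map_pow,
      AddValuation.map_pow, hp, val_x_self, ← WithTop.coe_nsmul, ← WithTop.coe_nsmul,
      ← WithTop.coe_nsmul]
    have e1 : k • big = k.toNat • big := by rw [← natCast_zsmul, Int.toNat_of_nonneg hk]
    have e2 : l • small = l.toNat • small - (-l).toNat • small := by
      rw [← natCast_zsmul, ← natCast_zsmul, ← sub_smul]
      congr 1
      omega
    rw [e1, e2]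
    rfl
  have h2 : ∀ o, o ≠ some 1 → val 1 o f = 0 := by
    intro o ho
    rw [hf, AddValuation.map_mul, AddValuation.map_div, AddValuation.map_pow, AddValuation.map_pow,
      AddValuation.map_pow, hp' o ho, val_x_of_ne 1 ho]
    simp
  obtain ⟨c, hc⟩ := h.exists_eq f fun o => by
    by_cases ho : o = some 1
    · rw [ho, h1, WithTop.coe_nonneg]
      exact hγ
    · rw [h2 o ho]
  exact ⟨c, hc ▸ h1, fun o ho => hc ▸ h2 o ho⟩

/-- The value group at `some 1` has just one proper nonzero convex subgroup. If `P ≤ deep`, powers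
of any nonzero element of `deep` overtake a nonzero element of `P`; if `P` has an element of value
`m • small`, the `m`-th power of any element of the center does. -/
theorem eq_deep_or_isMaximal (h : IsValRing 1 j) {P : Ideal A} (hP : P.IsPrime) (hP0 : P ≠ ⊥) :
    P = h.deep ∨ P.IsMaximal := by
  obtain ⟨o, ho⟩ := h.exists_le_center hP.ne_top
  by_cases ho1 : o = some 1
  · subst ho1
    by_cases hd : P ≤ h.deep
    · left
      refine le_antisymm hd fun f hf => ?_
      obtain ⟨g, hg, hg0⟩ := Submodule.exists_mem_ne_zero_of_ne_bot hP0
      by_cases hf0 : f = 0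
      · exact hf0 ▸ zero_mem _
      obtain ⟨n, hn⟩ := exists_val_le_nsmul (j g) (h.map_ne_zero hg0) 1 (some 1)
      obtain ⟨k, l, -, hkl⟩ := h.exists_val_eq hf0 (some 1)
      have hk := (h.mem_deep_iff_of_eq hkl).1 hf
      refine h.mem_prime_of_le hP ho hg hg0 (k := n + 1) (hn.trans ?_)
      rw [map_pow, AddValuation.map_pow, hkl, ← WithTop.coe_nsmul, WithTop.coe_le_coe]
      have e1 : (n + 1) • (k • big + l • small)
          = (((n : ℤ) + 1) * k) • big + (((n : ℤ) + 1) * l) • small := by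
        module
      have e2 : n • big = (n : ℤ) • big + (0 : ℤ) • small := by
        module
      rw [e1, e2, zsmul_add_le_iff]
      left
      nlinarith
    · right
      obtain ⟨g, hg, hgd⟩ := SetLike.not_le_iff_exists.1 hd
      obtain ⟨m, hm⟩ := (h.mem_deep_or g).resolve_left hgd
      have hg0 : g ≠ 0 := fun h0 => hgd (h0 ▸ zero_mem _)
      have : P = h.center (some 1) := by
        refine le_antisymm ho fun f hf => h.mem_prime_of_le hP ho hg hg0 (k := m) ?_
        rw [hm, map_pow, AddValuation.map_pow, WithTop.coe_nsmul]
        exact nsmul_le_nsmul_right hf m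
      rw [this]
      exact h.center_isMaximal _
  · right
    rw [h.eq_center_of_isRegularPlace hP hP0 (isRegularPlace_of_ne ho1) ho]
    exact h.center_isMaximal o

theorem deep_ne_bot (h : IsValRing 1 j) : h.deep ≠ ⊥ := by
  obtain ⟨c, hc, -⟩ := h.exists_val_one_eq big_pos.le
  refine Submodule.ne_bot_iff _ |>.2 ⟨c, ?_, ?_⟩
  · rw [h.mem_deep_iff_of_eq (k := 1) (l := 0) (by simp [hc])]
  · rintro rfl
    simp at hc

theorem deep_lt_center (h : IsValRing 1 j) : h.deep < h.center (some 1) := by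
  refine SetLike.lt_iff_le_and_exists.2 ⟨fun a ha => ?_, ?_⟩
  · have := h.mem_deep.1 ha 1
    rwa [one_smul] at this
  · obtain ⟨c, hc, -⟩ := h.exists_val_one_eq small_pos.le
    exact ⟨c, hc.ge, h.notMem_deep (m := 1) (by rw [hc, one_smul])⟩

theorem ringKrullDim_eq_two [IsDomain A] (h : IsValRing 1 j) : ringKrullDim A = 2 := by
  classical
  apply le_antisymm
  · have key : ringKrullDim A < ((3 : ℕ) : WithBot ℕ∞) := by
      refine Order.krullDim_lt_coe_iff.2 fun l => ?_
      -- A strictly monotone rank function bounds the length of chains of primes: the levels are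
      -- zero, `deep`, and the maximal ideals.
      let r : PrimeSpectrum A → Fin 3 := fun P =>
        if P.asIdeal = ⊥ then 0 else if P.asIdeal = h.deep then 1 else 2
      have hr : StrictMono r := by
        intro P Q hPQ
        have hlt : P.asIdeal < Q.asIdeal := hPQ
        have hQ : Q.asIdeal ≠ ⊥ := (bot_le.trans_lt hlt).ne'
        by_cases hP : P.asIdeal = ⊥
        · simp only [r, hP, hQ, if_true, if_false]
          split_ifs <;> decide
        · rcases h.eq_deep_or_isMaximal P.2 hP with hd | hm
          · have hQd : Q.asIdeal ≠ h.deep := fun hQd => (hd ▸ hQd ▸ hlt).false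
            simp only [r, hQ, hQd, hd, h.deep_ne_bot, if_true, if_false]
            decide
          · exact absurd (hm.eq_of_le Q.2.ne_top hlt.le) hlt.ne
      have := (l.map r hr).length_lt_card
      simpa using this
    exact Order.le_of_lt_succ key
  · have : ((2 : ℕ) : WithBot ℕ∞) ≤ ringKrullDim A := by
      refine Order.le_krullDim_iff.2 ⟨⟨2, ![⟨⊥, Ideal.isPrime_bot⟩, ⟨h.deep, h.deep_isPrime⟩,
        ⟨h.center (some 1), h.center_isPrime _⟩], ?_⟩, rfl⟩
      intro i
      fin_cases i
      · exact bot_lt_iff_ne_bot.2 h.deep_ne_bot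
      · exact h.deep_lt_center
    exact_mod_cast this

/-- The finiteness condition fails: an element vanishing at all regular places lies in the center of
`some (i + 1)` for every `i`, where the shift avoids the irregular place. -/
theorem not_isHLocal [IsDomain A] (h : IsValRing 1 j) : ¬ IsHLocal A := by
  rintro ⟨-, hfin⟩
  obtain ⟨u, -, hu, -⟩ := h.exists_mem_layer (⊥ : Ideal A)
  have hu0 : u ≠ 0 := by
    rintro rfl
    have := hu none (isRegularPlace_of_ne (by simp))
    simp at this
  have hne : ∀ i : ℕ+, some (i + 1) ≠ some (1 : ℕ+) := fun i hi =>
    (PNat.lt_add_left 1 i).ne' (Option.some_injective _ hi)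
  have := hfin (Ideal.span {u}) (by rwa [Ne, Ideal.span_singleton_eq_bot])
  have hle : ∀ i : ℕ+, Ideal.span {u} ≤ h.center (some (i + 1)) := fun i => by
    rw [Ideal.span_singleton_le_iff_mem, mem_center, hu _ (isRegularPlace_of_ne (hne i))]
    exact WithTop.coe_pos.2 big_pos
  let F : ℕ+ → MaximalSpectrum (A ⧸ Ideal.span {u}) := fun i =>
    ⟨(h.center (some (i + 1))).map (Ideal.Quotient.mk _),
      (h.center_isMaximal _).map_of_surjective_of_ker_le Ideal.Quotient.mk_surjective
        (by rw [Ideal.mk_ker]; exact hle i)⟩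
  have hF : Function.Injective F := by
    intro i k hik
    have h1 := congrArg (fun M => Ideal.comap (Ideal.Quotient.mk _) M.asIdeal) hik
    simp only [F] at h1
    rw [Ideal.comap_map_mk (hle i), Ideal.comap_map_mk (hle k)] at h1
    exact add_right_cancel (Option.some_injective _ (h.eq_of_center_le h1.le))
  exact not_finite_iff_infinite.2 (Infinite.of_injective F hF) this

end IsValRing

/-! ### The ISP factorization -/

theorem isInvertibleIdeal_span_singleton {A : Type*} [CommRing A] [IsDomain A] {c : A}
    (hc : c ≠ 0) : IsInvertibleIdeal (Ideal.span {c}) := by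
  have h0 : algebraMap A (FractionRing A) c ≠ 0 := by
    rwa [Ne, FaithfulSMul.algebraMap_eq_zero_iff]
  unfold IsInvertibleIdeal
  rw [FractionalIdeal.coeIdeal_span_singleton]
  refine IsUnit.of_mul_eq_one
    (FractionalIdeal.spanSingleton _ (algebraMap A (FractionRing A) c)⁻¹) ?_
  rw [FractionalIdeal.spanSingleton_mul_spanSingleton, mul_inv_cancel₀ h0,
    FractionalIdeal.spanSingleton_one]

theorem prod_filter_ne_top {A : Type*} [CommRing A] [DecidableEq (Ideal A)]
    (Q : Multiset (Ideal A)) : (Q.filter (· ≠ ⊤)).prod = Q.prod := by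
  induction Q using Multiset.induction_on with
  | empty => simp
  | cons J Q ih =>
    by_cases hJ : J = ⊤
    · have h1 : (J ::ₘ Q).filter (· ≠ ⊤) = Q.filter (· ≠ ⊤) :=
        Multiset.filter_cons_of_neg Q (not_not.2 hJ)
      rw [h1, ih, Multiset.prod_cons, hJ,
        ← Ideal.one_eq_top, one_mul]
    · have h1 : (J ::ₘ Q).filter (· ≠ ⊤) = J ::ₘ Q.filter (· ≠ ⊤) :=
        Multiset.filter_cons_of_pos Q hJ
      rw [h1, Multiset.prod_cons, Multiset.prod_cons, ih]

namespace IsValRing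

variable {A : Type*} [CommRing A] {j : A →+* RatField}

theorem val_map_mul (o : Option ℕ+) (a b : A) :
    val 1 o (j (a * b)) = val 1 o (j a) + val 1 o (j b) := by
  rw [map_mul, AddValuation.map_mul]

theorem exists_ne_zero_of_val_eq {c : A} {o : Option ℕ+} {γ : ValGroup}
    (hc : val 1 o (j c) = (γ : WithTop ValGroup)) : c ≠ 0 := by
  rintro rfl
  simp at hc

/-- If there is no least value at `some 1`, then the values are unbounded below with constant
first component. -/
theorem exists_forall_val_le (h : IsValRing 1 j) {I : Ideal A} (hI : I ≠ ⊥)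
    (hmin : ∀ g ∈ I, g ≠ 0 → ∃ g' ∈ I, val 1 (some 1) (j g') < val 1 (some 1) (j g)) :
    ∃ k : ℤ, 1 ≤ k ∧
      (∀ l : ℤ, ∃ g ∈ I, val 1 (some 1) (j g)
        ≤ ((k • big + l • small : ValGroup) : WithTop ValGroup)) ∧
      ∀ g ∈ I, g ≠ 0 → ∃ k' l' : ℤ, k ≤ k' ∧
        val 1 (some 1) (j g) = ((k' • big + l' • small : ValGroup) : WithTop ValGroup) := by
  classical
  -- The least first component occurring in `I`. With it fixed, the absence of a minimum makes the
  -- second component descend without bound.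
  have hex : ∃ k : ℕ, ∃ g ∈ I, ∃ l : ℤ, val 1 (some 1) (j g)
      = (((k : ℤ) • big + l • small : ValGroup) : WithTop ValGroup) := by
    obtain ⟨g, hg, hg0⟩ := Submodule.exists_mem_ne_zero_of_ne_bot hI
    obtain ⟨k, l, hk, hkl⟩ := h.exists_val_eq hg0 (some 1)
    lift k to ℕ using hk
    exact ⟨k, g, hg, l, hkl⟩
  have hmink : ∀ g ∈ I, g ≠ 0 → ∃ k' l' : ℤ, (Nat.find hex : ℤ) ≤ k' ∧
      val 1 (some 1) (j g) = ((k' • big + l' • small : ValGroup) : WithTop ValGroup) := by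
    intro g hg hg0
    obtain ⟨k, l, hk, hkl⟩ := h.exists_val_eq hg0 (some 1)
    lift k to ℕ using hk
    exact ⟨k, l, by exact_mod_cast Nat.find_min' hex ⟨g, hg, l, hkl⟩, hkl⟩
  obtain ⟨g₀, hg₀, l₀, hgl₀⟩ := Nat.find_spec hex
  have hdesc : ∀ d : ℕ, ∃ g ∈ I, ∃ l : ℤ, l ≤ l₀ - d ∧ val 1 (some 1) (j g)
      = (((Nat.find hex : ℤ) • big + l • small : ValGroup) : WithTop ValGroup) := by
    intro d
    induction d with
    | zero => exact ⟨g₀, hg₀, l₀, by simp, hgl₀⟩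
    | succ d ih =>
      obtain ⟨g, hg, l, hl, hgl⟩ := ih
      obtain ⟨g', hg', hlt⟩ := hmin g hg (exists_ne_zero_of_val_eq hgl)
      have hg'0 : g' ≠ 0 := by
        rintro rfl
        simp at hlt
      obtain ⟨k', l', hk', hkl'⟩ := hmink g' hg' hg'0
      rw [hgl, hkl', WithTop.coe_lt_coe, zsmul_add_lt_iff] at hlt
      have hk'' : k' = Nat.find hex := by omega
      subst hk''
      exact ⟨g', hg', l', by push_cast; omega, hkl'⟩
  have hall : ∀ l : ℤ, ∃ g ∈ I, val 1 (some 1) (j g)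
      ≤ (((Nat.find hex : ℤ) • big + l • small : ValGroup) : WithTop ValGroup) := by
    intro l
    obtain ⟨g, hg, l', hl', hgl⟩ := hdesc (l₀ - l).toNat
    refine ⟨g, hg, ?_⟩
    rw [hgl, WithTop.coe_le_coe, zsmul_add_le_iff]
    right
    exact ⟨rfl, by omega⟩
  refine ⟨Nat.find hex, ?_, hall, hmink⟩
  by_contra hlt
  -- For `k = 0` an element of value at most `-small` would exist, against nonnegativity.
  obtain ⟨g, hg, hgl⟩ := hall (-1)
  have h0 := (h.nonneg g (some 1)).trans hgl
  rw [WithTop.coe_nonneg] at h0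
  have := @zsmul_add_le_iff 0 0 (Nat.find hex) (-1)
  simp only [zero_smul, zero_add] at this
  rw [this] at h0
  omega

/-- At the place `some 1`, each nonzero ideal has the same values as a principal ideal times
a product of proper radical ideals. -/
theorem exists_span_mul_prod (h : IsValRing 1 j) {I : Ideal A} (hI : I ≠ ⊥) :
    ∃ (c : A) (Q : Multiset (Ideal A)), c ≠ 0 ∧ (∀ H ∈ Q, H ≠ ⊤ ∧ H.IsRadical) ∧
      (Q = 0 → Ideal.span {c} = ⊤) ∧
      (∀ f ∈ Ideal.span {c} * Q.prod, ∃ g ∈ I, val 1 (some 1) (j g) ≤ val 1 (some 1) (j f)) ∧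
      (∀ g ∈ I, ∃ f ∈ Ideal.span {c} * Q.prod, val 1 (some 1) (j f) ≤ val 1 (some 1) (j g)) ∧
      ∀ o, o ≠ some 1 → ∃ f ∈ Ideal.span {c} * Q.prod, val 1 o (j f) = 0 := by
  by_cases hmin : ∃ g ∈ I, g ≠ 0 ∧ ∀ g' ∈ I, val 1 (some 1) (j g) ≤ val 1 (some 1) (j g')
  · obtain ⟨g, hg, hg0, hmin⟩ := hmin
    obtain ⟨γ, hγ⟩ := WithTop.ne_top_iff_exists.1 (val_ne_top 1 (some 1) (h.map_ne_zero hg0))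
    have hγ0 : 0 ≤ γ := by
      rw [← WithTop.coe_nonneg, hγ]
      exact h.nonneg g _
    rw [← hγ] at hmin
    -- Least value zero: the trivial factorization. Positive least value `γ`: since `small` is the
    -- least value on the center, an element of value `γ - small` times the center has least value
    -- `γ`.
    rcases hγ0.eq_or_lt with h0 | hpos
    · refine ⟨1, 0, ?_, by simp, by simp, fun f _ => ⟨g, hg, ?_⟩, fun g' hg' => ⟨1, by simp, ?_⟩,
        fun o _ => ⟨1, by simp, by simp⟩⟩
      · rintro h10
        exact hg0 (by rw [← one_mul g, h10, zero_mul])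
      · rw [← hγ, ← h0]
        exact h.nonneg f _
      · rw [map_one, AddValuation.map_one]
        exact h.nonneg g' _
    · obtain ⟨c, hc, hc'⟩ := h.exists_val_one_eq (sub_nonneg.2 (small_le_of_pos hpos))
      obtain ⟨d, hd, hd'⟩ := h.exists_val_one_eq small_pos.le
      have hcd : val 1 (some 1) (j (c * d)) = (γ : WithTop ValGroup) := by
        rw [val_map_mul, hc, hd, ← WithTop.coe_add, sub_add_cancel]
      have hmem : c * d ∈ Ideal.span {c} * h.center (some 1) :=
        Ideal.mem_span_singleton_mul.2 ⟨d, hd.ge, rfl⟩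
      refine ⟨c, {h.center (some 1)}, exists_ne_zero_of_val_eq hc, ?_, by simp, ?_, ?_, ?_⟩
      · intro H hH
        rw [Multiset.mem_singleton.1 hH]
        exact ⟨(h.center_isPrime _).ne_top, (h.center_isPrime _).isRadical⟩
      all_goals rw [Multiset.prod_singleton]
      · intro f hf
        obtain ⟨e, he, rfl⟩ := Ideal.mem_span_singleton_mul.1 hf
        refine ⟨g, hg, ?_⟩
        rw [← hγ, ← hcd, val_map_mul, val_map_mul, hd]
        gcongr
        exact he
      · exact fun g' hg' => ⟨c * d, hmem, hcd ▸ hmin g' hg'⟩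
      · exact fun o ho => ⟨c * d, hmem, by rw [val_map_mul, hc' o ho, hd' o ho, add_zero]⟩
  · push Not at hmin
    obtain ⟨k, hk, hall, hval⟩ := h.exists_forall_val_le hI hmin
    have hk0 : 0 ≤ (k - 1) • big := zsmul_nonneg big_pos.le (by omega)
    -- No least value: `deep` consists of the elements with first component at least one, so an
    -- element of value `(k - 1) • big` shifts this bound to `k`.
    obtain ⟨c, hc, hc'⟩ := h.exists_val_one_eq hk0
    have hlow : ∀ l : ℤ, ∃ d ∈ h.deep,
        val 1 (some 1) (j (c * d)) = ((k • big + l • small : ValGroup) : WithTop ValGroup) ∧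
        ∀ o, o ≠ some 1 → val 1 o (j (c * d)) = 0 := by
      intro l
      have hpos : 0 ≤ (1 : ℤ) • big + l • small := by
        have := @zsmul_add_le_iff 0 0 1 l
        simp only [zero_smul, zero_add] at this
        rw [this]
        omega
      obtain ⟨d, hd, hd'⟩ := h.exists_val_one_eq hpos
      refine ⟨d, (h.mem_deep_iff_of_eq hd).2 le_rfl, ?_, fun o ho => ?_⟩
      · rw [val_map_mul, hc, hd, ← WithTop.coe_add]
        congr 1
        module
      · rw [val_map_mul, hc' o ho, hd' o ho, add_zero]
    refine ⟨c, {h.deep}, exists_ne_zero_of_val_eq hc, ?_, by simp, ?_, ?_, ?_⟩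
    · intro H hH
      rw [Multiset.mem_singleton.1 hH]
      exact ⟨h.deep_isPrime.ne_top, h.deep_isPrime.isRadical⟩
    all_goals rw [Multiset.prod_singleton]
    · intro f hf
      obtain ⟨e, he, rfl⟩ := Ideal.mem_span_singleton_mul.1 hf
      by_cases he0 : e = 0
      · exact ⟨0, zero_mem _, by simp [he0]⟩
      obtain ⟨a, b, -, hab⟩ := h.exists_val_eq he0 (some 1)
      have ha := (h.mem_deep_iff_of_eq hab).1 he
      obtain ⟨g, hg, hgl⟩ := hall b
      refine ⟨g, hg, hgl.trans ?_⟩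
      rw [val_map_mul, hc, hab, ← WithTop.coe_add, WithTop.coe_le_coe]
      have e1 : (k - 1) • big + (a • big + b • small) = (k - 1 + a) • big + b • small := by module
      rw [e1, zsmul_add_le_iff]
      omega
    · intro g hg
      by_cases hg0 : g = 0
      · exact ⟨0, zero_mem _, by simp [hg0]⟩
      obtain ⟨k', l', hk', hkl'⟩ := hval g hg hg0
      obtain ⟨d, hd, hd1, -⟩ := hlow l'
      refine ⟨c * d, Ideal.mem_span_singleton_mul.2 ⟨d, hd, rfl⟩, ?_⟩
      rw [hd1, hkl', WithTop.coe_le_coe, zsmul_add_le_iff]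
      omega
    · intro o ho
      obtain ⟨d, hd, -, hd2⟩ := hlow 0
      exact ⟨c * d, Ideal.mem_span_singleton_mul.2 ⟨d, hd, rfl⟩, hd2 o ho⟩

/-- The factorization at `some 1` contains elements that are units at any given regular place, and
the product of layers contains a unit at `some 1`. Their product thus has the values of `I`
everywhere, and equals `I`. -/
theorem isISPDomain [IsDomain A] (h : IsValRing 1 j) : IsISPDomain A := by
  classical
  intro I hItop hI
  obtain ⟨c, Q₀, hc0, hQ₀, hQ₀0, hL1, hL2, hL3⟩ := h.exists_span_mul_prod hI
  obtain ⟨Q, hQ, h1, h2, h3⟩ := h.exists_prod_isRadical hI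
  have hreg : ∀ {o : Option ℕ+}, o ≠ some 1 → IsRegularPlace 1 o :=
    fun ho => isRegularPlace_of_ne ho
  have heq : I = Ideal.span {c} * Q₀.prod * Q.prod := by
    apply le_antisymm
    · refine h.le_of_forall_exists_le fun g hg o => ?_
      by_cases ho : o = some 1
      · subst ho
        obtain ⟨f, hf, hfg⟩ := hL2 g hg
        obtain ⟨q, hq, hq0⟩ := h3 (some 1) not_isRegularPlace_one
        exact ⟨f * q, Ideal.mul_mem_mul hf hq, by rwa [val_map_mul, hq0, add_zero]⟩
      · obtain ⟨f, hf, hf0⟩ := hL3 o ho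
        obtain ⟨q, hq, hqg⟩ := h2 o (hreg ho) g hg
        exact ⟨f * q, Ideal.mul_mem_mul hf hq, by rwa [val_map_mul, hf0, zero_add]⟩
    · have hle1 : Ideal.span {c} * Q₀.prod * Q.prod ≤ Ideal.span {c} * Q₀.prod := Ideal.mul_le_left
      have hle2 : Ideal.span {c} * Q₀.prod * Q.prod ≤ Q.prod := Ideal.mul_le_right
      refine h.le_of_forall_exists_le fun f hf o => ?_
      by_cases ho : o = some 1
      · subst ho
        exact hL1 f (hle1 hf)
      · exact h1 o (hreg ho) f (hle2 hf)
  refine ⟨Ideal.span {c}, Q₀ + Q.filter (· ≠ ⊤), isInvertibleIdeal_span_singleton hc0, ?_, ?_, ?_⟩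
  -- If no proper factor were left, the principal factor would also be trivial and `I` would be the
  -- whole ring.
  · intro h0
    obtain ⟨h01, h02⟩ := add_eq_zero.1 h0
    refine hItop ?_
    rw [heq, ← prod_filter_ne_top Q, h02, hQ₀0 h01, h01]
    simp
  · intro H hH
    rcases Multiset.mem_add.1 hH with hH | hH
    · exact hQ₀ H hH
    · obtain ⟨hH1, hH2⟩ := Multiset.mem_filter.1 hH
      exact ⟨hH2, hQ H hH1⟩
  · rw [Multiset.prod_add, prod_filter_ne_top, ← mul_assoc]
    exact heq

end IsValRing

/-! ## The residue field at `some 1` -/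

/-- The substitution `x₁ ↦ 0`, `z 1 ↦ t`. -/
def residuePoly : Poly →ₐ[ℚ] Polynomial (MvPolynomial {n : ℕ+ // 2 ≤ n} ℚ) :=
  aeval fun o => o.elim Polynomial.X fun i =>
    if h : 2 ≤ i then Polynomial.C (X ⟨i, h⟩) else 0

theorem residuePoly_X_none : residuePoly (X none) = Polynomial.X := by simp [residuePoly]

theorem residuePoly_X_one : residuePoly (X (some 1)) = 0 := by
  have h : ¬ (2 : ℕ+) ≤ 1 := by decide
  simp [residuePoly, h]

theorem residuePoly_X_some {i : ℕ+} (hi : 2 ≤ i) :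
    residuePoly (X (some i)) = Polynomial.C (X ⟨i, hi⟩) := by simp [residuePoly, hi]

theorem two_le_of_ne_one {i : ℕ+} (hi : i ≠ 1) : 2 ≤ i := by
  rw [← PNat.coe_le_coe]
  have h1 := i.pos
  have h2 : (i : ℕ) ≠ 1 := fun h => hi (PNat.coe_eq_one_iff.1 h)
  change 2 ≤ (i : ℕ)
  omega

/-- The section of `residuePoly`. -/
def residueSection : Polynomial (MvPolynomial {n : ℕ+ // 2 ≤ n} ℚ) →+* Poly :=
  Polynomial.eval₂RingHom (rename fun i => some i.1 : _ →ₐ[ℚ] Poly).toRingHom (X none)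

theorem residuePoly_residueSection (P : Polynomial (MvPolynomial {n : ℕ+ // 2 ≤ n} ℚ)) :
    residuePoly (residueSection P) = P := by
  have : (residuePoly : Poly →+* _).comp residueSection = RingHom.id _ := by
    refine Polynomial.ringHom_ext' (MvPolynomial.ringHom_ext (fun r => ?_) fun i => ?_) ?_
    · simp [residueSection, residuePoly]
    · simp [residueSection, residuePoly_X_some i.2]
    · simp [residueSection, residuePoly_X_none]
  exact RingHom.congr_fun this P

theorem X_dvd_sub_residueSection (P : Poly) :
    X (some 1) ∣ P - residueSection (residuePoly P) := by
  induction P using MvPolynomial.induction_on with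
  | C a => simp [residuePoly, residueSection]
  | add p q hp hq =>
    rw [map_add, map_add, add_sub_add_comm]
    exact dvd_add hp hq
  | mul_X p o hp =>
    have h1 : X (some 1) ∣ X o - residueSection (residuePoly (X o)) := by
      rcases o with _ | i
      · simp [residuePoly_X_none, residueSection]
      · by_cases hi : i = 1
        · rw [hi, residuePoly_X_one, map_zero, sub_zero]
        · simp [residuePoly_X_some (two_le_of_ne_one hi), residueSection]
    rw [map_mul, map_mul]
    have h2 : p * X o - residueSection (residuePoly p) * residueSection (residuePoly (X o))
        = (p - residueSection (residuePoly p)) * X o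
          + residueSection (residuePoly p) * (X o - residueSection (residuePoly (X o))) := by ring
    rw [h2]
    exact dvd_add (dvd_mul_of_dvd_left hp _) (dvd_mul_of_dvd_right h1 _)

theorem residuePoly_eq_zero_iff {P : Poly} : residuePoly P = 0 ↔ X (some 1) ∣ P := by
  constructor
  · intro h
    simpa [h] using X_dvd_sub_residueSection P
  · rintro ⟨Q, rfl⟩
    rw [map_mul, residuePoly_X_one, zero_mul]

/-- If every monomial contained a variable killed by `φ`, then `φ P` would vanish. In
`val_embed_eq_zero` the surviving monomial has weight zero. -/
theorem exists_mem_support_of_map_ne_zero {R : Type*} [CommRing R] (φ : Poly →+* R) {P : Poly}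
    (h : φ P ≠ 0) : ∃ α ∈ P.support, ∀ o, φ (X o) = 0 → α o = 0 := by
  by_contra! hcon
  refine h ?_
  rw [P.as_sum, map_sum]
  refine Finset.sum_eq_zero fun α hα => ?_
  obtain ⟨o, ho, hαo⟩ := hcon α hα
  obtain ⟨Q, hQ⟩ := X_dvd_monomial.2 (Or.inr hαo : coeff α P = 0 ∨ α o ≠ 0)
  rw [hQ, map_mul, ho, zero_mul]

/-- The embedding of the polynomial ring in the coordinates `z 1, x₁, x₂, …`. -/
abbrev embed : Poly →ₐ[ℚ] RatField := aeval (gen 1)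

theorem embed_injective : Function.Injective embed := gen_algebraicIndependent 1

theorem embed_X_some (i : ℕ+) : embed (X (some i)) = x i := by simp [embed, gen]

theorem embed_X_none : embed (X none) = z 1 := by simp [embed, gen]

theorem val_embed_eq_zero {ε : ℕ} {R : Type*} [CommRing R] (φ : Poly →+* R) {P : Poly}
    (h : φ P ≠ 0) (hφ : ∀ o, φ (X o) ≠ 0 → genWeight ε 1 (some 1) o = 0) :
    val ε (some 1) (embed P) = 0 := by
  rw [val_aeval_gen]
  apply le_antisymm
  · obtain ⟨α, hα, h0⟩ := exists_mem_support_of_map_ne_zero φ h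
    refine (weightOrder_le hα).trans (le_of_eq ?_)
    rw [Finsupp.weight_apply, Finsupp.sum, Finset.sum_eq_zero, WithTop.coe_zero]
    intro o _
    by_cases ho : φ (X o) = 0
    · rw [h0 o ho, zero_smul]
    · rw [hφ o ho]
      exact nsmul_zero _
  · rw [le_weightOrder_iff]
    intro α _
    rw [WithTop.coe_nonneg, Finsupp.weight_apply]
    exact Finset.sum_nonneg fun o _ => nsmul_nonneg (genWeight_nonneg _ _ _ _) _

theorem val_zero_embed {P : Poly} (h : residuePoly P ≠ 0) : val 0 (some 1) (embed P) = 0 := by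
  refine val_embed_eq_zero residuePoly.toRingHom h fun o ho => ?_
  rcases o with _ | i
  · simp [genWeight]
  · by_cases hi : i = 1
    · rw [hi] at ho
      exact absurd residuePoly_X_one ho
    · simp [genWeight, placeWeight, Ne.symm hi]

theorem val_embed_nonneg (ε : ℕ) (P : Poly) : 0 ≤ val ε (some 1) (embed P) := by
  rw [val_aeval_gen, le_weightOrder_iff]
  intro α _
  rw [WithTop.coe_nonneg, Finsupp.weight_apply]
  exact Finset.sum_nonneg fun o _ => nsmul_nonneg (genWeight_nonneg _ _ _ _) _

theorem big_le_val_embed {ε : ℕ} {P : Poly} (h : residuePoly P = 0) :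
    (big : WithTop ValGroup) ≤ val ε (some 1) (embed P) := by
  obtain ⟨Q, rfl⟩ := residuePoly_eq_zero_iff.1 h
  rw [map_mul, AddValuation.map_mul, embed_X_some, val_x_self]
  exact le_add_of_nonneg_right (val_embed_nonneg ε Q)

/-- The value of a polynomial at `some 1` is read off from its residue. -/
theorem exists_val_one_embed {P : Poly} (h : residuePoly P ≠ 0) :
    ∃ (k : ℕ) (c : Polynomial (MvPolynomial {n : ℕ+ // 2 ≤ n} ℚ)), c.coeff 0 ≠ 0 ∧
      residuePoly P = Polynomial.X ^ k * c ∧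
      val 1 (some 1) (embed P) = ((k • small : ValGroup) : WithTop ValGroup) := by
  obtain ⟨k, c, hc, hk⟩ := WfDvdMonoid.max_power_factor h
    (Polynomial.prime_X (R := MvPolynomial {n : ℕ+ // 2 ≤ n} ℚ)).irreducible
  rw [Polynomial.X_dvd_iff] at hc
  refine ⟨k, c, hc, hk, ?_⟩
  have hz : val 1 (some 1) (embed (X none)) = (small : WithTop ValGroup) := by
    rw [embed_X_none, val_z_one, if_pos rfl, one_smul]
  have h1 : val 1 (some 1) (embed (residueSection c)) = 0 := by
    refine val_embed_eq_zero
      (Polynomial.constantCoeff.comp residuePoly.toRingHom) ?_ fun o ho => ?_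
    · simpa [residuePoly_residueSection] using hc
    · rcases o with _ | i
      · exact absurd (by simp [residuePoly_X_none]) ho
      · by_cases hi : i = 1
        · rw [hi] at ho
          exact absurd (by simp [residuePoly_X_one]) ho
        · simp [genWeight, placeWeight, Ne.symm hi]
  obtain ⟨R, hR⟩ := X_dvd_sub_residueSection P
  -- `P` is the lift of its residue `t ^ k c` modulo `x₁`. The first term has value `k • small`, and
  -- the second at least `big`, which is larger.
  have hP : embed P = embed (X none) ^ k * embed (residueSection c) + x 1 * embed R := by
    rw [← embed_X_some 1, ← map_mul, ← hR, hk, map_mul, map_pow, ← map_pow, ← map_mul, ← map_add]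
    congr 1
    have : residueSection Polynomial.X = X none := by simp [residueSection]
    rw [this]
    ring
  have h2 : val 1 (some 1) (embed (X none) ^ k * embed (residueSection c))
      = ((k • small : ValGroup) : WithTop ValGroup) := by
    rw [AddValuation.map_mul, AddValuation.map_pow, hz, h1, add_zero, WithTop.coe_nsmul]
  rw [hP, AddValuation.map_add_eq_of_lt_left, h2]
  rw [h2, AddValuation.map_mul, val_x_self]
  exact (WithTop.coe_lt_coe.2 (nsmul_small_lt_big k)).trans_le
    (le_add_of_nonneg_right (val_embed_nonneg 1 R))

theorem exists_embed_eq (P : Poly) : ∃ Q, embed Q = algebraMap Poly RatField P := by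
  induction P using MvPolynomial.induction_on with
  | C a => exact ⟨MvPolynomial.C a, by simp [embed, algebraMap_C]⟩
  | add p q hp hq =>
    obtain ⟨p', hp⟩ := hp
    obtain ⟨q', hq⟩ := hq
    exact ⟨p' + q', by rw [map_add, map_add, hp, hq]⟩
  | mul_X p o hp =>
    obtain ⟨p', hp⟩ := hp
    rcases o with _ | i
    · refine ⟨p' * (X (some 1) * X none), ?_⟩
      rw [map_mul, map_mul, map_mul, hp, embed_X_some, embed_X_none, ← y_eq]
      rfl
    · refine ⟨p' * X (some i), ?_⟩
      rw [map_mul, map_mul, hp, embed_X_some]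
      rfl

theorem embed_ne_zero {P : Poly} (hP : P ≠ 0) : embed P ≠ 0 :=
  (map_ne_zero_iff _ embed_injective).2 hP

/-- All powers of `x₁` are extracted from numerator and denominator in the coordinates `z 1, x₁, x₂,
…`, leaving nonzero residues. -/
theorem exists_mul_embed_eq {f : RatField} (hf : f ≠ 0) : ∃ (k l : ℕ) (a b : Poly),
    residuePoly a ≠ 0 ∧ residuePoly b ≠ 0 ∧ f * (x 1 ^ l * embed b) = x 1 ^ k * embed a := by
  obtain ⟨P, Q, hQ, rfl⟩ := IsFractionRing.div_surjective (A := Poly) f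
  obtain ⟨a, ha⟩ := exists_embed_eq P
  obtain ⟨b, hb⟩ := exists_embed_eq Q
  rw [← ha, ← hb] at hf ⊢
  have ha0 : a ≠ 0 := by
    rintro rfl
    simp at hf
  have hb0 : b ≠ 0 := by
    rintro rfl
    simp at hf
  have hirr := (X_prime (R := ℚ) (i := (some 1 : Option ℕ+))).irreducible
  obtain ⟨k, a', ha', rfl⟩ := WfDvdMonoid.max_power_factor ha0 hirr
  obtain ⟨l, b', hb', rfl⟩ := WfDvdMonoid.max_power_factor hb0 hirr
  refine ⟨k, l, a', b', residuePoly_eq_zero_iff.not.2 ha', residuePoly_eq_zero_iff.not.2 hb', ?_⟩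
  rw [← embed_X_some, ← map_pow, ← map_pow, ← map_mul, ← map_mul]
  exact div_mul_cancel₀ _ (embed_ne_zero hb0)

theorem val_x_pow_mul_embed_zero (k : ℕ) {a : Poly} (ha : residuePoly a ≠ 0) :
    val 0 (some 1) (x 1 ^ k * embed a) = ((k • big : ValGroup) : WithTop ValGroup) := by
  rw [AddValuation.map_mul, AddValuation.map_pow, val_x_self, val_zero_embed ha, add_zero,
    WithTop.coe_nsmul]

/-- The valuation with `ε = 0` is the first component of the rank-two valuation: the exponents of
`x₁` determine it in both cases. -/
theorem val_zero_nonneg_of_val_one_nonneg {f : RatField} (h : 0 ≤ val 1 (some 1) f) :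
    0 ≤ val 0 (some 1) f := by
  by_cases hf : f = 0
  · simp [hf]
  obtain ⟨k, l, a, b, ha, hb, hab⟩ := exists_mul_embed_eq hf
  have hb0 : x 1 ^ l * embed b ≠ 0 := by
    refine mul_ne_zero (pow_ne_zero _ (x_ne_zero 1)) (embed_ne_zero ?_)
    rintro rfl
    simp at hb
  rw [← mul_div_cancel_right₀ f hb0, ← val_le_val_iff _ _ hb0, hab] at h ⊢
  rw [val_x_pow_mul_embed_zero k ha, val_x_pow_mul_embed_zero l hb, WithTop.coe_le_coe,
    IsValRing.nsmul_big_le_iff]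
  obtain ⟨m, -, -, -, hm⟩ := exists_val_one_embed ha
  obtain ⟨n, -, -, -, hn⟩ := exists_val_one_embed hb
  rw [AddValuation.map_mul, AddValuation.map_mul, AddValuation.map_pow, AddValuation.map_pow,
    val_x_self, hm, hn, ← WithTop.coe_nsmul, ← WithTop.coe_nsmul, ← WithTop.coe_add,
    ← WithTop.coe_add, WithTop.coe_le_coe, ← natCast_zsmul, ← natCast_zsmul, ← natCast_zsmul,
    ← natCast_zsmul, zsmul_add_le_iff] at h
  omega

theorem exists_embed_div {f : RatField} (h : 0 ≤ val 0 (some 1) f) :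
    ∃ a b : Poly, residuePoly b ≠ 0 ∧ f * embed b = embed a := by
  by_cases hf : f = 0
  · exact ⟨0, 1, by simp, by simp [hf]⟩
  obtain ⟨k, l, a, b, ha, hb, hab⟩ := exists_mul_embed_eq hf
  have hkl : l ≤ k := by
    have h1 := congrArg (val 0 (some 1)) hab
    rw [AddValuation.map_mul, val_x_pow_mul_embed_zero k ha, val_x_pow_mul_embed_zero l hb] at h1
    have h2 := le_add_of_nonneg_left (a := ((l • big : ValGroup) : WithTop ValGroup)) h
    rw [h1, WithTop.coe_le_coe] at h2
    exact IsValRing.nsmul_big_le_iff.1 h2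
  refine ⟨X (some 1) ^ (k - l) * a, b, hb, ?_⟩
  have hx : x 1 ^ l ≠ 0 := pow_ne_zero _ (x_ne_zero 1)
  apply mul_left_cancel₀ hx
  have hpow : x 1 ^ k = x 1 ^ l * x 1 ^ (k - l) := by rw [← pow_add, Nat.add_sub_cancel' hkl]
  rw [map_mul, map_pow, embed_X_some, ← mul_assoc _ _ (embed a), ← hpow, ← hab]
  ring

/-! ## The residue map -/

/-- Sending `a / b` to `ψ a / ψ b` is well defined by cross-multiplication in `P`, where `g` is
injective. -/
theorem exists_ringHom_of_fractions {P F L : Type*} [CommRing P] [Field F] [Field L]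
    (g : P →+* F) (hg : Function.Injective g) (ψ : P →+* L) {S : Type*} [CommRing S]
    (i : S →+* F) (hS : ∀ s : S, ∃ a b : P, ψ b ≠ 0 ∧ i s * g b = g a) :
    ∃ ρ : S →+* L, ∀ (s : S) (a b : P), i s * g b = g a → ρ s * ψ b = ψ a := by
  choose a b hb hab using hS
  have key : ∀ (s : S) (a' b' : P), i s * g b' = g a' → ψ (a s) / ψ (b s) * ψ b' = ψ a' := by
    intro s a' b' h
    have h1 : a s * b' = a' * b s := by
      apply hg
      rw [map_mul, map_mul, ← hab, ← h]
      ring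
    have h2 := congrArg ψ h1
    rw [map_mul, map_mul] at h2
    rw [div_mul_eq_mul_div, h2, mul_div_cancel_right₀ _ (hb s)]
  have key' : ∀ (s : S) (a' b' : P), ψ b' ≠ 0 → i s * g b' = g a' →
      ψ (a s) / ψ (b s) = ψ a' / ψ b' := fun s a' b' hb' h => by
    rw [eq_div_iff hb', key s a' b' h]
  refine ⟨⟨⟨⟨fun s => ψ (a s) / ψ (b s), ?_⟩, ?_⟩, ?_, ?_⟩, key⟩
  · rw [key' 1 1 1 (by simp) (by simp)]
    simp
  · intro s t
    change ψ (a (s * t)) / ψ (b (s * t)) = ψ (a s) / ψ (b s) * (ψ (a t) / ψ (b t))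
    rw [key' (s * t) (a s * a t) (b s * b t) (by simp [hb])
      (by rw [map_mul, map_mul, map_mul, ← hab, ← hab]; ring), map_mul, map_mul, div_mul_div_comm]
  · change ψ (a 0) / ψ (b 0) = 0
    rw [key' 0 0 1 (by simp) (by simp)]
    simp
  · intro s t
    change ψ (a (s + t)) / ψ (b (s + t)) = ψ (a s) / ψ (b s) + ψ (a t) / ψ (b t)
    rw [key' (s + t) (a s * b t + b s * a t) (b s * b t) (by simp [hb])
      (by rw [map_add, map_mul, map_add, map_mul, map_mul, ← hab, ← hab]; ring), map_add, map_mul,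
      map_mul, map_mul, div_add_div _ _ (hb s) (hb t)]

/-- The embedding of the residues of polynomials in `K[t]`. -/
def toPolyK : Polynomial (MvPolynomial {n : ℕ+ // 2 ≤ n} ℚ) →+* Polynomial K :=
  Polynomial.mapRingHom (algebraMap _ K)

theorem toPolyK_injective : Function.Injective toPolyK :=
  Polynomial.map_injective _ (FaithfulSMul.algebraMap_injective _ K)

/-- The residue in `K(t)` of a polynomial. -/
def residue : Poly →+* RatFunc K :=
  ((algebraMap (Polynomial K) (RatFunc K)).comp toPolyK).comp residuePoly.toRingHom

theorem residue_apply (P : Poly) :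
    residue P = algebraMap (Polynomial K) (RatFunc K) (toPolyK (residuePoly P)) := rfl

theorem residue_ne_zero_iff {P : Poly} : residue P ≠ 0 ↔ residuePoly P ≠ 0 := by
  rw [residue_apply, Ne, map_eq_zero_iff _ (RatFunc.algebraMap_injective K),
    map_eq_zero_iff _ toPolyK_injective]

theorem exists_residueMap : ∃ ρ : C →+* RatFunc K, ∀ (f : C) (a b : Poly),
    (f : RatField) * embed b = embed a → ρ f * residue b = residue a :=
  exists_ringHom_of_fractions (embed : Poly →+* RatField) embed_injective residue
    (C.val : C →+* RatField) fun f => by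
      obtain ⟨a, b, hb, h⟩ := exists_embed_div (isValRing_C.nonneg f (some 1))
      exact ⟨a, b, residue_ne_zero_iff.2 hb, h⟩

/-! ## The discrete valuation ring `K[t]_(t)` -/

theorem mem_localRing_iff {f : RatFunc K} : f ∈ localRing ↔ ∃ p s : Polynomial K,
    s.coeff 0 ≠ 0 ∧ f * algebraMap (Polynomial K) (RatFunc K) s = algebraMap _ _ p := by
  have h0 : ∀ s : Polynomial K,
      s ∈ (Ideal.span {(Polynomial.X : Polynomial K)}).primeCompl ↔ s.coeff 0 ≠ 0 := fun s => by
    rw [Ideal.mem_primeCompl_iff, Ideal.mem_span_singleton, Polynomial.X_dvd_iff]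
  have hne : ∀ s : Polynomial K, s.coeff 0 ≠ 0 →
      algebraMap (Polynomial K) (RatFunc K) s ≠ 0 := fun s hs =>
    (map_ne_zero_iff _ (RatFunc.algebraMap_injective K)).2 fun h => hs (by simp [h])
  constructor
  · rintro ⟨p, s, hs, rfl⟩
    exact ⟨p, s, (h0 s).1 hs, by rw [inv_mul_cancel_right₀ (hne s ((h0 s).1 hs))]⟩
  · rintro ⟨p, s, hs, h⟩
    exact ⟨p, s, (h0 s).2 hs, by rw [← h, mul_inv_cancel_right₀ (hne s hs)]⟩

theorem algebraMap_mem_localRing (p : Polynomial K) : algebraMap _ (RatFunc K) p ∈ localRing :=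
  mem_localRing_iff.2 ⟨p, 1, by simp, by simp⟩

theorem isDiscreteValuationRing_localRing : IsDiscreteValuationRing localRing := by
  have h : Ideal.span {(Polynomial.X : Polynomial K)} ≠ ⊥ := by
    rw [Ne, Ideal.span_singleton_eq_bot]
    exact Polynomial.X_ne_zero
  have : IsLocalization.AtPrime (Localization.subalgebra.ofField (RatFunc K)
      (Ideal.span {(Polynomial.X : Polynomial K)}).primeCompl
      (Ideal.primeCompl_le_nonZeroDivisors _)) (Ideal.span {(Polynomial.X : Polynomial K)}) :=
    Localization.subalgebra.isLocalization_ofField _ _ _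
  exact IsLocalization.AtPrime.isDiscreteValuationRing_of_dedekind_domain (Polynomial K) h
    (Localization.subalgebra.ofField (RatFunc K)
      (Ideal.span {(Polynomial.X : Polynomial K)}).primeCompl
      (Ideal.primeCompl_le_nonZeroDivisors _))

theorem mem_localRing_or_inv {f : RatFunc K} (hf : f ∈ localRing) :
    f⁻¹ ∈ localRing ∨ ∃ g ∈ localRing, f = RatFunc.X * g := by
  obtain ⟨p, s, hs, h⟩ := mem_localRing_iff.1 hf
  have hs0 : algebraMap (Polynomial K) (RatFunc K) s ≠ 0 :=
    (map_ne_zero_iff _ (RatFunc.algebraMap_injective K)).2 fun h => hs (by simp [h])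
  by_cases hp : p.coeff 0 = 0
  · right
    obtain ⟨q, rfl⟩ := Polynomial.X_dvd_iff.2 hp
    refine ⟨algebraMap _ _ q / algebraMap _ _ s,
      mem_localRing_iff.2 ⟨q, s, hs, div_mul_cancel₀ _ hs0⟩, ?_⟩
    rw [← mul_div_assoc, eq_div_iff hs0, h, map_mul, RatFunc.algebraMap_X]
  · left
    have hp0 : algebraMap (Polynomial K) (RatFunc K) p ≠ 0 :=
      (map_ne_zero_iff _ (RatFunc.algebraMap_injective K)).2 fun h => hp (by simp [h])
    refine mem_localRing_iff.2 ⟨s, p, hp, ?_⟩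
    have hf0 : f ≠ 0 := by
      rintro rfl
      rw [zero_mul] at h
      exact hp0 h.symm
    rw [← h, ← mul_assoc, inv_mul_cancel₀ hf0, one_mul]

/-- Nonzero constant terms make `c` and `d` units of `K[t]_(t)`, so only the exponent `k - l` of `t`
counts. -/
theorem X_pow_mul_div_mem_localRing_iff {k l : ℕ} {c d : Polynomial K} (hc : c.coeff 0 ≠ 0)
    (hd : d.coeff 0 ≠ 0) {f : RatFunc K}
    (hf : f * algebraMap _ _ (Polynomial.X ^ l * d) = algebraMap _ _ (Polynomial.X ^ k * c)) :
    f ∈ localRing ↔ l ≤ k := by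
  have hX : (Polynomial.X : Polynomial K) ≠ 0 := Polynomial.X_ne_zero
  have hXl : algebraMap (Polynomial K) (RatFunc K) (Polynomial.X ^ l) ≠ 0 :=
    (map_ne_zero_iff _ (RatFunc.algebraMap_injective K)).2 (pow_ne_zero _ hX)
  constructor
  · intro hmem
    obtain ⟨p, s, hs, h⟩ := mem_localRing_iff.1 hmem
    have h1 : Polynomial.X ^ l * d * p = Polynomial.X ^ k * c * s := by
      apply RatFunc.algebraMap_injective K
      rw [map_mul, map_mul _ _ s, ← hf, ← h]
      ring
    by_contra! hlt
    have h2 : Polynomial.X ^ (l - k) * d * p = c * s := by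
      apply mul_left_cancel₀ (pow_ne_zero k hX)
      rw [← mul_assoc, ← mul_assoc, ← pow_add, Nat.add_sub_cancel' hlt.le, h1, mul_assoc]
    have h3 : (c * s).coeff 0 = 0 := by
      rw [← h2, ← Polynomial.X_dvd_iff, mul_assoc]
      exact dvd_mul_of_dvd_left (dvd_pow_self _ (by omega)) _
    rw [Polynomial.mul_coeff_zero] at h3
    exact mul_ne_zero hc hs h3
  · intro hlk
    refine mem_localRing_iff.2 ⟨Polynomial.X ^ (k - l) * c, d, hd, mul_left_cancel₀ hXl ?_⟩
    rw [← map_mul, ← mul_assoc (Polynomial.X ^ l), ← pow_add, Nat.add_sub_cancel' hlk, ← hf,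
      map_mul]
    ring

/-! ## The isomorphism `C ⧸ x₁ C ≅ K(t)` -/

/-- `ρ` sends a quotient of polynomials to the quotient of their residues. -/
def IsResidueMap (ρ : C →+* RatFunc K) : Prop :=
  ∀ (f : C) (a b : Poly), (f : RatField) * embed b = embed a → ρ f * residue b = residue a

namespace IsResidueMap

variable {ρ : C →+* RatFunc K}

theorem apply_eq (hρ : IsResidueMap ρ) {f : C} {a : Poly} (h : (f : RatField) = embed a) :
    ρ f = residue a := by
  have := hρ f a 1 (by rw [map_one, mul_one, h])
  rwa [map_one, mul_one] at this

theorem apply_xC_one (hρ : IsResidueMap ρ) : ρ (xC 1) = 0 := by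
  rw [hρ.apply_eq (a := X (some 1)) (embed_X_some 1).symm, residue_apply,
    residuePoly_X_one, map_zero, map_zero]

theorem apply_xC (hρ : IsResidueMap ρ) {n : ℕ+} (hn : 2 ≤ n) : ρ (xC n) =
    RatFunc.C (algebraMap (MvPolynomial {n : ℕ+ // 2 ≤ n} ℚ) K (X ⟨n, hn⟩)) := by
  rw [hρ.apply_eq (a := X (some n)) (embed_X_some n).symm, residue_apply,
    residuePoly_X_some hn, ← RatFunc.algebraMap_C]
  congr 1
  exact Polynomial.map_C _

theorem apply_zC_one (hρ : IsResidueMap ρ) : ρ (zC 1) = RatFunc.X := by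
  rw [hρ.apply_eq (a := X none) embed_X_none.symm, residue_apply,
    residuePoly_X_none, ← RatFunc.algebraMap_X]
  congr 1
  exact Polynomial.map_X _

/-- The kernel is a proper ideal containing the maximal ideal `x₁C`. -/
theorem ker_eq (hρ : IsResidueMap ρ) : RingHom.ker ρ = Ideal.span {xC 1} := by
  have hmax : (Ideal.span {xC 1}).IsMaximal := (isMaximal_C_iff _).2 (Or.inr ⟨1, rfl⟩)
  refine (hmax.eq_of_le (RingHom.ker_ne_top ρ) ?_).symm
  rw [Ideal.span_singleton_le_iff_mem, RingHom.mem_ker]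
  exact hρ.apply_xC_one

theorem inv_mem_range (hρ : IsResidueMap ρ) {f : RatFunc K} (hf : f ∈ ρ.range) : f⁻¹ ∈ ρ.range := by
  obtain ⟨a, rfl⟩ := hf
  by_cases ha : ρ a = 0
  · rw [ha, inv_zero]
    exact zero_mem _
  have hmax : (Ideal.span {xC 1}).IsMaximal := (isMaximal_C_iff _).2 (Or.inr ⟨1, rfl⟩)
  have ha' : a ∉ Ideal.span {xC 1} := by
    rw [← hρ.ker_eq]
    exact ha
  obtain ⟨b, c, hc, hbc⟩ := hmax.exists_inv ha'
  rw [← hρ.ker_eq, RingHom.mem_ker] at hc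
  have h1 := congrArg ρ hbc
  rw [map_add, map_mul, hc, add_zero, map_one] at h1
  exact ⟨b, eq_inv_of_mul_eq_one_left h1⟩

/-- The kernel is maximal, so the range is a subfield of `K(t)`; it contains `t` and the `xₙ` with
`n ≥ 2`, which generate. -/
theorem surjective (hρ : IsResidueMap ρ) : Function.Surjective ρ := by
  have hdiv : ∀ a ∈ ρ.range, ∀ b ∈ ρ.range, a / b ∈ ρ.range := fun a ha b hb => by
    rw [div_eq_mul_inv]
    exact mul_mem ha (hρ.inv_mem_range hb)
  have hrat : ∀ q : ℚ, (algebraMap ℚ (RatFunc K) q) ∈ ρ.range := fun q =>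
    ⟨algebraMap ℚ C q, RingHom.congr_fun (Subsingleton.elim (ρ.comp (algebraMap ℚ C))
      (algebraMap ℚ (RatFunc K))) q⟩
  have hpoly : ∀ P : MvPolynomial {n : ℕ+ // 2 ≤ n} ℚ,
      RatFunc.C (algebraMap _ K P) ∈ ρ.range := by
    intro P
    induction P using MvPolynomial.induction_on with
    | C a =>
      have : RatFunc.C (algebraMap _ K (MvPolynomial.C a : MvPolynomial {n : ℕ+ // 2 ≤ n} ℚ))
          = algebraMap ℚ (RatFunc K) a :=
        RingHom.congr_fun (Subsingleton.elim
          ((RatFunc.C.comp (algebraMap _ K)).comp MvPolynomial.C) (algebraMap ℚ (RatFunc K))) a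
      rw [this]
      exact hrat a
    | add p q hp hq =>
      rw [map_add, map_add]
      exact add_mem hp hq
    | mul_X p i hp =>
      rw [map_mul, map_mul]
      have hX : RatFunc.C (algebraMap _ K (X i)) ∈ ρ.range := ⟨xC i.1, hρ.apply_xC i.2⟩
      exact mul_mem hp hX
  have hK : ∀ k : K, RatFunc.C k ∈ ρ.range := by
    intro k
    obtain ⟨a, b, -, rfl⟩ :=
      IsFractionRing.div_surjective (A := MvPolynomial {n : ℕ+ // 2 ≤ n} ℚ) k
    rw [map_div₀]
    exact hdiv _ (hpoly a) _ (hpoly b)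
  have hKX : ∀ p : Polynomial K, algebraMap _ (RatFunc K) p ∈ ρ.range := by
    intro p
    induction p using Polynomial.induction_on' with
    | add p q hp hq =>
      rw [map_add]
      exact add_mem hp hq
    | monomial n a =>
      rw [← Polynomial.C_mul_X_pow_eq_monomial, map_mul, map_pow, RatFunc.algebraMap_C,
        RatFunc.algebraMap_X]
      have hX : RatFunc.X ∈ ρ.range := ⟨zC 1, hρ.apply_zC_one⟩
      exact mul_mem (hK a) (pow_mem hX n)
  intro f
  rw [← RatFunc.num_div_denom f]
  exact hdiv _ (hKX _) _ (hKX _)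

/-- Write `f` as a fraction whose denominator has nonzero residue. If the numerator also does, both
conditions compare the powers of `t` in the two residues; if not, the residue of `f` is zero and the
value of the numerator is at least `big`, so both conditions hold. -/
theorem apply_mem_localRing_iff (hρ : IsResidueMap ρ) (f : C) :
    ρ f ∈ localRing ↔ 0 ≤ val 1 (some 1) (f : RatField) := by
  obtain ⟨a, b, hb, hab⟩ := exists_embed_div (isValRing_C.nonneg f (some 1))
  change (f : RatField) * embed b = embed a at hab
  have hres := hρ f a b hab
  have hb0 : embed b ≠ 0 := embed_ne_zero fun h => hb (by rw [h, map_zero])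
  have hf : (f : RatField) = embed a / embed b := by rw [← hab, mul_div_cancel_right₀ _ hb0]
  rw [hf, ← val_le_val_iff _ _ hb0]
  obtain ⟨l, d, hd, hbd, hl⟩ := exists_val_one_embed hb
  by_cases ha : residuePoly a = 0
  · have h1 : residue a = 0 := by rw [residue_apply, ha, map_zero, map_zero]
    rw [h1] at hres
    rw [(mul_eq_zero.1 hres).resolve_right (residue_ne_zero_iff.2 hb), hl]
    exact iff_of_true (zero_mem _) ((WithTop.coe_le_coe.2 (nsmul_small_lt_big l).le).trans
      (big_le_val_embed ha))
  · obtain ⟨k, c, hc, hac, hk⟩ := exists_val_one_embed ha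
    have hcoeff : ∀ c : Polynomial (MvPolynomial {n : ℕ+ // 2 ≤ n} ℚ), c.coeff 0 ≠ 0 →
        (toPolyK c).coeff 0 ≠ 0 := fun c hc => by
      rw [toPolyK, Polynomial.coe_mapRingHom, Polynomial.coeff_map]
      exact (map_ne_zero_iff _ (FaithfulSMul.algebraMap_injective _ K)).2 hc
    have hX : toPolyK Polynomial.X = Polynomial.X := Polynomial.map_X _
    rw [hk, hl, coe_nsmul_small_le_iff]
    refine X_pow_mul_div_mem_localRing_iff (hcoeff c hc) (hcoeff d hd) ?_
    rw [residue_apply, residue_apply, hac, hbd, map_mul, map_mul toPolyK, map_pow, map_pow, hX]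
      at hres
    exact hres

end IsResidueMap

/-! ### The pullback as an intersection of valuation rings -/

section Pullback

variable {e : (C ⧸ Ideal.span {xC 1}) ≃+* RatFunc K}

theorem val_eq_of_ne (ε : ℕ) {o : Option ℕ+} (ho : o ≠ some 1) : val ε o = val 0 o := by
  have h : placeWeight ε o = placeWeight 0 o := by
    funext v
    rcases o with _ | i <;> rcases v with _ | v
    · rfl
    · rfl
    · have : i ≠ 1 := fun h => ho (congrArg some h)
      simp [placeWeight, this]
    · rfl
  rw [val, val, h]

/-- Passing to the pullback changes the condition at `some 1` only. Conversely, nonnegativity of the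
rank-two value already implies the condition defining `C` at that place. -/
theorem isValRing_pullbackRing
    (he : ∀ f : C, e (Ideal.Quotient.mk _ f) ∈ localRing ↔ 0 ≤ val 1 (some 1) (f : RatField)) :
    IsValRing 1 ((C.val : C →+* RatField).comp
      (pullbackRing (xC 1) (localRing.comap (e : _ →+* RatFunc K))).subtype) where
  injective := Subtype.val_injective.comp Subtype.val_injective
  nonneg a o := by
    by_cases ho : o = some 1
    · rw [ho]
      exact (he a.1).1 a.2
    · have := isValRing_C.nonneg a.1 o
      rw [val_eq_of_ne 1 ho]
      exact this
  exists_eq f hf := by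
    have hfC : f ∈ C := mem_C_iff.2 fun o => by
      by_cases ho : o = some 1
      · rw [ho]
        exact val_zero_nonneg_of_val_one_nonneg (hf (some 1))
      · rw [← val_eq_of_ne 1 ho]
        exact hf o
    exact ⟨⟨⟨f, hfC⟩, (he ⟨f, hfC⟩).2 (hf (some 1))⟩, rfl⟩

end Pullback

/-! ### Transport of `K[t]_(t)` to the residue field of `C` -/

section Comap

variable {R : Type*} [CommRing R] (e : R ≃+* RatFunc K)

theorem isDomain_comap_localRing : IsDomain (localRing.comap (e : R →+* RatFunc K)) := by
  have : IsDomain R := MulEquiv.isDomain (RatFunc K) e.toMulEquiv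
  infer_instance

theorem isFractionRing_comap_localRing :
    IsFractionRing (localRing.comap (e : R →+* RatFunc K)) R := by
  have := isDomain_comap_localRing e
  refine ⟨⟨fun d => ?_, fun f => ?_, fun {a b} h => ⟨1, by rw [Subtype.ext h]⟩⟩⟩
  · have h0 : e d.1.1 ≠ 0 := by
      rw [map_ne_zero_iff _ e.injective]
      intro h
      exact nonZeroDivisors.coe_ne_zero d (Subtype.ext h)
    exact (MulEquiv.isUnit_map e).1 h0.isUnit
  · have hq : algebraMap (Polynomial K) (RatFunc K) (e f).denom ≠ 0 :=
      RatFunc.algebraMap_ne_zero (e f).denom_ne_zero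
    have hmem : ∀ p : Polynomial K,
        e.symm (algebraMap _ _ p) ∈ localRing.comap (e : R →+* RatFunc K) := fun p => by
      rw [Subring.mem_comap, RingEquiv.coe_toRingHom, RingEquiv.apply_symm_apply]
      exact algebraMap_mem_localRing p
    refine ⟨⟨⟨_, hmem (e f).num⟩, ⟨_, hmem (e f).denom⟩, ?_⟩, e.injective ?_⟩
    · refine mem_nonZeroDivisors_of_ne_zero fun h => hq ?_
      have := congrArg e (congrArg Subtype.val h)
      rwa [RingEquiv.apply_symm_apply, Subring.coe_zero, map_zero] at this
    · change e (f * e.symm _) = e (e.symm _)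
      rw [map_mul, RingEquiv.apply_symm_apply, RingEquiv.apply_symm_apply]
      nth_rw 1 [← RatFunc.num_div_denom (e f)]
      exact div_mul_cancel₀ _ hq

/-- The restriction of `e` to the preimage of `localRing`. -/
def comapLocalRingEquiv : localRing ≃+* localRing.comap (e : R →+* RatFunc K) where
  toFun f := ⟨e.symm f, by
    rw [Subring.mem_comap, RingEquiv.coe_toRingHom, RingEquiv.apply_symm_apply]
    exact f.2⟩
  invFun f := ⟨e f, f.2⟩
  left_inv f := Subtype.ext (e.apply_symm_apply f.1)
  right_inv f := Subtype.ext (e.symm_apply_apply f.1)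
  map_mul' f g := Subtype.ext (map_mul e.symm f.1 g.1)
  map_add' f g := Subtype.ext (map_add e.symm f.1 g.1)

theorem dvr_comap_localRing {p : R} (hp : e p = RatFunc.X) :
    ∃ (_ : IsDomain (localRing.comap (e : R →+* RatFunc K)))
      (_ : IsDiscreteValuationRing (localRing.comap (e : R →+* RatFunc K)))
      (hpD : p ∈ localRing.comap (e : R →+* RatFunc K)),
      IsLocalRing.maximalIdeal (localRing.comap (e : R →+* RatFunc K)) =
        Ideal.span {⟨p, hpD⟩} := by
  have h1 := isDomain_comap_localRing e
  have h2 := isDiscreteValuationRing_localRing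
  have h3 : IsDiscreteValuationRing (localRing.comap (e : R →+* RatFunc K)) :=
    IsDiscreteValuationRing.RingEquivClass.isDiscreteValuationRing (comapLocalRingEquiv e)
  have hpD : p ∈ localRing.comap (e : R →+* RatFunc K) := by
    rw [Subring.mem_comap, RingEquiv.coe_toRingHom, hp, ← RatFunc.algebraMap_X]
    exact algebraMap_mem_localRing _
  refine ⟨h1, h3, hpD, ?_⟩
  ext a
  rw [IsLocalRing.mem_maximalIdeal, mem_nonunits_iff, Ideal.mem_span_singleton]
  constructor
  · intro ha
    rcases mem_localRing_or_inv a.2 with h | ⟨g, hg, h⟩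
    · by_cases ha0 : a = 0
      · rw [ha0]
        exact dvd_zero _
      refine absurd (IsUnit.of_mul_eq_one (comapLocalRingEquiv e ⟨_, h⟩)
        (Subtype.ext (e.injective ?_))) ha
      have hea : e a.1 ≠ 0 := by
        rw [map_ne_zero_iff _ e.injective]
        exact fun h => ha0 (Subtype.ext h)
      change e (a.1 * e.symm (e a.1)⁻¹) = e 1
      rw [map_mul, RingEquiv.apply_symm_apply, mul_inv_cancel₀ hea, map_one]
    · refine ⟨comapLocalRingEquiv e ⟨g, hg⟩, Subtype.ext (e.injective ?_)⟩
      change e a.1 = e (p * e.symm g)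
      rw [map_mul, RingEquiv.apply_symm_apply, hp]
      exact h
  · rintro ⟨b, rfl⟩ hu
    obtain ⟨c, hc⟩ := (isUnit_of_mul_isUnit_left hu).exists_right_inv
    have hc' : RatFunc.X * e c.1 = 1 := by
      have := congrArg e (congrArg Subtype.val hc)
      rwa [Subring.coe_mul, Subring.coe_one, map_mul, map_one, hp] at this
    -- An inverse of `t` would be `t⁰ / t¹`, which is excluded because `1 ≤ 0` fails.
    have hmem := (X_pow_mul_div_mem_localRing_iff (k := 0) (l := 1) (c := 1) (d := 1) (by simp)
      (by simp) (f := e c.1) (by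
        rw [pow_one, pow_zero, mul_one, mul_one, map_one, RatFunc.algebraMap_X, mul_comm]
        exact hc')).1 c.2
    omega

end Comap

/-! ### Assembling the example -/

theorem isUnit_pivot : IsUnit (xC 1 + zC 1) := by
  have h : ((xC 1 + zC 1 : C) : RatField) = pivot := rfl
  have hv : ∀ o, val 0 o pivot = 0 := fun o => by
    rw [val_pivot]
    simp
  refine isUnit_of_dvd_one (isValRing_C.dvd fun o => ?_)
  rw [map_one, AddValuation.map_one]
  exact (hv o).le

theorem exists_residueFieldEquiv : ∃ e : (C ⧸ Ideal.span {xC 1}) ≃+* RatFunc K,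
    (∀ (n : ℕ+) (hn : 2 ≤ n), e (Ideal.Quotient.mk _ (xC n)) =
      RatFunc.C (algebraMap (MvPolynomial {n : ℕ+ // 2 ≤ n} ℚ) K (X ⟨n, hn⟩))) ∧
    e (Ideal.Quotient.mk _ (xC 1 + zC 1)) = RatFunc.X ∧
    e (Ideal.Quotient.mk _ (zC 1)) = RatFunc.X ∧
    ∀ f : C, e (Ideal.Quotient.mk _ f) ∈ localRing ↔ 0 ≤ val 1 (some 1) (f : RatField) := by
  obtain ⟨ρ, hρ⟩ := exists_residueMap
  replace hρ : IsResidueMap ρ := hρ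
  have hsum : ρ (xC 1 + zC 1) = RatFunc.X := by
    rw [map_add, hρ.apply_xC_one, hρ.apply_zC_one, zero_add]
  exact ⟨(Ideal.quotEquivOfEq hρ.ker_eq.symm).trans
    (RingHom.quotientKerEquivOfSurjective hρ.surjective), fun n hn => hρ.apply_xC hn,
    hsum, hρ.apply_zC_one, hρ.apply_mem_localRing_iff⟩

end ExampleC

end

theorem mainTheorem5 :
    -- `C` is a one-dimensional Bezout SP-domain that is not Dedekind
    (ringKrullDim ExampleC.C = 1 ∧ IsBezout ExampleC.C ∧ IsSPDomain ExampleC.C ∧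
      ¬ IsDedekindDomain ExampleC.C) ∧
    -- the maximal ideals of `C` are `N` and the principal ideals `xₙ C`
    (∀ M : Ideal ExampleC.C, M.IsMaximal ↔
      M = ExampleC.N ∨ ∃ n : ℕ+, M = Ideal.span {ExampleC.xC n}) ∧
    -- `C ⧸ x₁ C ≅ K(t)` with `xₙ ↦ xₙ` for `n ≥ 2` and `y / x₁ ↦ t`; with `D` the subring
    -- corresponding to `K[t]_{(t)}` and `p = x₁ + y / x₁`, the pullback construction applies and
    -- yields a two-dimensional ISP-domain which is not h-local
    ∃ e : (ExampleC.C ⧸ Ideal.span {ExampleC.xC 1}) ≃+* RatFunc ExampleC.K,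
      (∀ (n : ℕ+) (hn : 2 ≤ n), e (Ideal.Quotient.mk _ (ExampleC.xC n)) =
        RatFunc.C (algebraMap (MvPolynomial {n : ℕ+ // 2 ≤ n} ℚ) ExampleC.K
          (MvPolynomial.X ⟨n, hn⟩))) ∧
      e (Ideal.Quotient.mk _ (ExampleC.zC 1)) = RatFunc.X ∧
      IsPullbackData ExampleC.C (ExampleC.xC 1) (ExampleC.xC 1 + ExampleC.zC 1)
        (ExampleC.localRing.comap (e : _ →+* RatFunc ExampleC.K)) ∧
      ringKrullDim (pullbackRing (ExampleC.xC 1)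
        (ExampleC.localRing.comap (e : _ →+* RatFunc ExampleC.K))) = 2 ∧
      IsISPDomain (pullbackRing (ExampleC.xC 1)
        (ExampleC.localRing.comap (e : _ →+* RatFunc ExampleC.K))) ∧
      ¬ IsHLocal (pullbackRing (ExampleC.xC 1)
        (ExampleC.localRing.comap (e : _ →+* RatFunc ExampleC.K))) := by
  obtain ⟨e, hx, hp, hz, he⟩ := ExampleC.exists_residueFieldEquiv
  have hA := ExampleC.isValRing_pullbackRing he
  refine ⟨⟨ExampleC.ringKrullDim_C, ExampleC.isValRing_C.isBezout, ExampleC.isSPDomain_C,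
    ExampleC.not_isDedekindDomain_C⟩, ExampleC.isMaximal_C_iff, e, hx, hz, ?_,
    hA.ringKrullDim_eq_two, hA.isISPDomain, hA.not_isHLocal⟩
  exact
    { isSPDomain := ExampleC.isSPDomain_C
      not_isDedekindDomain := ExampleC.not_isDedekindDomain_C
      isMaximal := (ExampleC.isMaximal_C_iff _).2 (Or.inr ⟨1, rfl⟩)
      isFractionRing := ExampleC.isFractionRing_comap_localRing e
      isUnit := ExampleC.isUnit_pivot
      dvr_and_generator := ExampleC.dvr_comap_localRing e hp }
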